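/- Let $T=(V,L)$ be the binary Cayley tree (the infinite tree in which every vertex has exactly $3$ neighbours), let $\beta>0$, $\tau=2\cosh\beta$ and $Q(m)=e^{-\beta|m|}$ for $m\in\mathbb Z$. Fix a root, orient every edge away from it, and let $\Omega^\nabla=\mathbb Z^{\vec L}$ be the space of gradient configurations with the product $\sigma$-algebra. For a height configuration $\omega\in\mathbb Z^V$ put $(\nabla\omega)_{\langle x,y\rangle}=\omega_y-\omega_x$. For finite $\Lambda\subset V$ let $\gamma_\Lambda(\cdot\mid\omega)$ be the probability measure on $\mathbb Z^V$ carried by the configurations $\sigma$ that agree with $\omega$ off $\Lambda$, with weights proportional to $\prod_{b\cap\Lambda\neq\emptyset}Q((\nabla\sigma)_b)$. For $\zeta\in\Omega^\nabla$ let $\gamma'_\Lambda(\cdot\mid\zeta)$ be the image of $\gamma_\Lambda(\cdot\mid\omega)$ under $\nabla$, where $\nabla\omega=\zeta$. A gradient Gibbs measure (GGM) of the SOS model is a probability measure $\nu$ on $\Omega^\nabla$ with $\int\gamma'_\Lambda(A\mid\zeta)\,\nu(d\zeta)=\nu(A)$ for all finite $\Lambda\subset V$ and all measurable $A$. A (spatially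 homogeneous) boundary law is a function $l:\mathbb Z\to(0,\infty)$ such that, for some $c>0$, $l(i)=c\big(\sum_{j\in\mathbb Z}Q(i-j)\,l(j)\big)^2$ for all $i\in\mathbb Z$, with convergent sums. The measure $\nu$ assigned to a $q$-periodic boundary law $l$ is given by the following marginals: for every finite connected non-empty $\Lambda\subset V$ with outer boundary $\partial\Lambda$, every $w\in\Lambda$ and every $\zeta\in\Omega^\nabla$, $$\nu\big(\eta_b=\zeta_b\text{ for all }b\subset\Lambda\cup\partial\Lambda\big)=Z_\Lambda\Big(\sum_{s=0}^{q-1}\ \prod_{y\in\partial\Lambda}l\Big(s+\sum_{b\in\Gamma(w,y)}\zeta_b\Big)\Big)\prod_{b\cap\Lambda\neq\emptyset}Q(\zeta_b),$$ where $Z_\Lambda>0$ is a normalising constant and $\sum_{b\in\Gamma(w,y)}\zeta_b$ is the sum along the path from $w$ to $y$, with a minus sign for edges that the path traverses against their orientation. Consider the GGMs that are assigned in this way to the boundary laws of the $4$-periodic form $z^{(a^2,b^2)}$ with $a,b>0$, where $z^{(a^2,b^2)}_n=1$ for even $n$, $a^2$ for $n\equiv1$ and $b^2$ for $n\equiv3\pmod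 4$. The number of distinct such GGMs is exactly one if $\tau\le4$, exactly two if $4<\tau\le6$, exactly three if $6<\tau\le2+2\sqrt5$, and exactly four if $\tau>2+2\sqrt5$. -/

import Mathlib

open MeasureTheory
open scoped ENNReal

noncomputable section

namespace SOS

variable {V : Type*}

/-- `(x, y)` is an edge of `G` that points away from the root `ρ`. -/
def Oriented (G : SimpleGraph V) (ρ : V) (p : V × V) : Prop :=
  G.Adj p.1 p.2 ∧ G.dist ρ p.2 = G.dist ρ p.1 + 1

/-- The edges of `G`, oriented away from the root `ρ`. -/
abbrev OEdge (G : SimpleGraph V) (ρ : V) : Type _ := {p : V × V // Oriented G ρ p}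

/-- Gradient configurations, with the product σ-algebra (`ℤ` carries its power set). -/
abbrev GradConf (G : SimpleGraph V) (ρ : V) : Type _ := OEdge G ρ → ℤ

/-- The gradient field of a height configuration. -/
def grad (G : SimpleGraph V) (ρ : V) (ω : V → ℤ) : GradConf G ρ :=
  fun b => ω b.1.2 - ω b.1.1

open Classical in
/-- The height increment `ω y - ω x` along a step from `x` to `y`, as prescribed by `ζ`:
the value of `ζ` if the step follows the orientation, minus that value if it goes against it. -/
def stepGrad {G : SimpleGraph V} {ρ : V} (ζ : GradConf G ρ) (x y : V) : ℤ :=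
  if h : Oriented G ρ (x, y) then ζ ⟨(x, y), h⟩
  else if h : Oriented G ρ (y, x) then -ζ ⟨(y, x), h⟩
  else 0

/-- The sum of `ζ` along the unique path from `x` to `y` in the tree `G`. -/
def pathSum {G : SimpleGraph V} (hG : G.IsTree) {ρ : V} (ζ : GradConf G ρ) (x y : V) : ℤ :=
  (((hG.existsUnique_path x y).choose.darts).map fun d => stepGrad ζ d.fst d.snd).sum

/-- The height configuration with gradient field `ζ` and height `0` at the root. -/
def heights {G : SimpleGraph V} (hG : G.IsTree) {ρ : V} (ζ : GradConf G ρ) : V → ℤ :=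
  fun y => pathSum hG ζ ρ y

open Classical in
/-- The outer boundary `∂Λ`: the vertices outside `Λ` with a neighbour in `Λ`. -/
def outerBoundary (G : SimpleGraph V) [G.LocallyFinite] (Λ : Finset V) : Finset V :=
  (Λ.biUnion fun x => G.neighborFinset x) \ Λ

open Classical in
/-- `Λ ∪ ∂Λ`. -/
def closureOf (G : SimpleGraph V) [G.LocallyFinite] (Λ : Finset V) : Finset V :=
  Λ ∪ outerBoundary G Λ

open Classical in
/-- The edges with at least one endpoint in `Λ` (see `mem_edgesMeeting`). -/
def edgesMeeting (G : SimpleGraph V) [G.LocallyFinite] (ρ : V) (Λ : Finset V) :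
    Finset (OEdge G ρ) :=
  ((closureOf G Λ ×ˢ closureOf G Λ).subtype (Oriented G ρ)).filter
    fun b => b.1.1 ∈ Λ ∨ b.1.2 ∈ Λ

theorem mem_edgesMeeting (G : SimpleGraph V) [G.LocallyFinite] (ρ : V) (Λ : Finset V)
    (b : OEdge G ρ) : b ∈ edgesMeeting G ρ Λ ↔ b.1.1 ∈ Λ ∨ b.1.2 ∈ Λ := by
  classical
  obtain ⟨⟨x, y⟩, h, h'⟩ := b
  have hxy : G.Adj x y := h
  have hyx : G.Adj y x := hxy.symm
  simp only [edgesMeeting, closureOf, outerBoundary, Finset.mem_filter, Finset.mem_subtype,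
    Finset.mem_product, Finset.mem_union, Finset.mem_sdiff, Finset.mem_biUnion,
    SimpleGraph.mem_neighborFinset]
  constructor
  · exact fun H => H.2
  · rintro (H | H)
    · exact ⟨⟨Or.inl H, (em (y ∈ Λ)).imp id fun hy => ⟨⟨x, H, hxy⟩, hy⟩⟩, Or.inl H⟩
    · exact ⟨⟨(em (x ∈ Λ)).imp id fun hx => ⟨⟨y, H, hyx⟩, hx⟩, Or.inl H⟩, Or.inr H⟩

/-- The transfer operator of the SOS model, as a function of the height difference. -/
def Q (β : ℝ) (m : ℤ) : ℝ := Real.exp (-β * |(m : ℝ)|)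

open Classical in
/-- The configuration that is `σ` on `Λ` and `ω` off `Λ`. -/
def glue (Λ : Finset V) (σ : Λ → ℤ) (ω : V → ℤ) : V → ℤ :=
  fun x => if h : x ∈ Λ then σ ⟨x, h⟩ else ω x

/-- The Boltzmann weight `exp (-β ∑ |ω x - ω y|)`, over the edges `⟨x, y⟩` that meet `Λ`. -/
def boltzmann (G : SimpleGraph V) [G.LocallyFinite] (ρ : V) (β : ℝ) (Λ : Finset V)
    (ω : V → ℤ) : ℝ≥0∞ :=
  ENNReal.ofReal (∏ b ∈ edgesMeeting G ρ Λ, Q β (grad G ρ ω b))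

/-- The partition function in `Λ` with boundary condition `ω`. -/
def partitionFn (G : SimpleGraph V) [G.LocallyFinite] (ρ : V) (β : ℝ) (Λ : Finset V)
    (ω : V → ℤ) : ℝ≥0∞ :=
  ∑' σ : Λ → ℤ, boltzmann G ρ β Λ (glue Λ σ ω)

/-- The Gibbs specification `γ_Λ(· | ω)` of the SOS model on height configurations. -/
def gibbsSpec (G : SimpleGraph V) [G.LocallyFinite] (ρ : V) (β : ℝ) (Λ : Finset V)
    (ω : V → ℤ) : Measure (V → ℤ) :=
  (partitionFn G ρ β Λ ω)⁻¹ •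
    Measure.sum fun σ : Λ → ℤ =>
      boltzmann G ρ β Λ (glue Λ σ ω) • Measure.dirac (glue Λ σ ω)

/-- The gradient Gibbs specification `γ'_Λ(· | ζ)`: the image under the gradient map of
`γ_Λ(· | ω)`, where `ω` is a height configuration with gradient field `ζ` (the result does not
depend on the height of `ω` at the root, which is set to `0`). -/
def gradSpec {G : SimpleGraph V} [G.LocallyFinite] (hG : G.IsTree) (ρ : V) (β : ℝ)
    (Λ : Finset V) (ζ : GradConf G ρ) : Measure (GradConf G ρ) :=
  (gibbsSpec G ρ β Λ (heights hG ζ)).map (grad G ρ)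

/-- Gradient Gibbs measures: probability measures on gradient configurations that satisfy
the DLR equation `ν γ'_Λ = ν` for every finite set `Λ` of vertices. -/
def IsGGM {G : SimpleGraph V} [G.LocallyFinite] (hG : G.IsTree) (ρ : V) (β : ℝ)
    (ν : Measure (GradConf G ρ)) : Prop :=
  IsProbabilityMeasure ν ∧
    ∀ Λ : Finset V, ∀ A : Set (GradConf G ρ), MeasurableSet A →
      ∫⁻ ζ, gradSpec hG ρ β Λ ζ A ∂ν = ν A

/-- Spatially homogeneous boundary laws of the SOS model on the Cayley tree of order `k`. -/
def IsBoundaryLaw (β : ℝ) (k : ℕ) (l : ℤ → ℝ) : Prop :=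
  (∀ i, 0 < l i) ∧ (∀ i, Summable fun j : ℤ => Q β (i - j) * l j) ∧
    ∃ c : ℝ, 0 < c ∧ ∀ i, l i = c * (∑' j : ℤ, Q β (i - j) * l j) ^ k

/-- `ν` is the measure assigned to the `q`-periodic homogeneous boundary law `l`: for each
finite connected `Λ` and each `w ∈ Λ`, its marginal on the edges in `Λ ∪ ∂Λ` is
`Z_Λ (∑_{s mod q} ∏_{y ∈ ∂Λ} l (s + ∑_{b ∈ Γ(w,y)} ζ_b)) ∏_{b ∩ Λ ≠ ∅} Q(ζ_b)`. -/
def HasMarginals {G : SimpleGraph V} [G.LocallyFinite] (hG : G.IsTree) (ρ : V) (β : ℝ)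
    (q : ℕ) (l : ℤ → ℝ) (ν : Measure (GradConf G ρ)) : Prop :=
  ∀ Λ : Finset V, (G.induce (Λ : Set V)).Connected →
    ∃ Z : ℝ, 0 < Z ∧ ∀ w ∈ Λ, ∀ ζ : GradConf G ρ,
      ν {η | ∀ b : OEdge G ρ, b.1.1 ∈ closureOf G Λ → b.1.2 ∈ closureOf G Λ → η b = ζ b} =
        ENNReal.ofReal (Z *
          (∑ s ∈ Finset.range q, ∏ y ∈ outerBoundary G Λ, l ((s : ℤ) + pathSum hG ζ w y)) *
          ∏ b ∈ edgesMeeting G ρ Λ, Q β (ζ b))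

/-- The 4-periodic function `z` with `(z 0, z 1, z 2, z 3) = (1, a², 1, b²)`. -/
def fourPeriodic (a b : ℝ) (n : ℤ) : ℝ :=
  if n % 4 = 1 then a ^ 2 else if n % 4 = 3 then b ^ 2 else 1

/-- The gradient Gibbs measures on the tree `G` that are assigned to a boundary law, for the
binary tree, of the form `(1, a², 1, b²)` with `a, b > 0`. -/
def fourPeriodicGGMs {G : SimpleGraph V} [G.LocallyFinite] (hG : G.IsTree) (ρ : V) (β : ℝ) :
    Set (Measure (GradConf G ρ)) :=
  {ν | IsGGM hG ρ β ν ∧ ∃ a b : ℝ, 0 < a ∧ 0 < b ∧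
    IsBoundaryLaw β 2 (fourPeriodic a b) ∧ HasMarginals hG ρ β 4 (fourPeriodic a b) ν}

end SOS

end

/-!
A periodic boundary law `l` defines a Markov chain of heights along the tree, with transition
probabilities proportional to `Q (j - i) * l j`. Since `l` is proportional to a power of its
convolution with `Q`, the product of the transition densities over the edges meeting `Λ` telescopes
to a product of values of `l` over `∂Λ`; averaging over the height of the root modulo the period
gives the measure assigned to `l`. It is a GGM because the remaining factor depends only on heights
off `Λ`, and it is unique because its marginals determine it.

The equation for `(1, a², 1, b²)` becomes algebraic because `Q` is a Green's function:
`Q (m + 1) + Q (m - 1) - τ Q m` vanishes for `m ≠ 0`. If `a = b`, the solutions are `a = 1` and the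
roots of `2 a² - (τ - 2) a + 2`, which are real and different from `1` exactly when `6 < τ`. If
`a ≠ b`, then `s = a + b` solves `s² - τ s + τ = 0` and `τ a b = 2 s`, so that `a` and `b` are real
and distinct exactly when `8 < τ s`: this holds for one root `s` if `4 < τ ≤ 2 + 2√5` and for both
if `τ` is larger.

Laws that differ by a factor or a shift of the heights have the same measure, which identifies
`(a, b)` with `(b, a)` and `(a, a)` with `(a⁻¹, a⁻¹)`. The marginal at a single vertex shows that
there are no other coincidences.
-/

noncomputable section

namespace SOS

section Tree

variable {V : Type*} {G : SimpleGraph V} {ρ : V}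

/-- `Λ` induces a connected, in particular non-empty, subgraph of `G`. -/
abbrev ConnectedOn (G : SimpleGraph V) (Λ : Finset V) : Prop := (G.induce (Λ : Set V)).Connected

theorem connectedOn_singleton (w : V) : ConnectedOn G {w} := by
  rw [ConnectedOn, Finset.coe_singleton]
  exact .mk .of_subsingleton

theorem ConnectedOn.union [DecidableEq V] {Λ Λ' : Finset V} (h : ConnectedOn G Λ)
    (h' : ConnectedOn G Λ') (hΛ : (Λ ∩ Λ').Nonempty) : ConnectedOn G (Λ ∪ Λ') := by
  rw [ConnectedOn, Finset.coe_union]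
  obtain ⟨x, hx⟩ := hΛ
  rw [Finset.mem_inter] at hx
  exact SimpleGraph.induce_union_connected h.preconnected h'.preconnected ⟨x, hx⟩

theorem ConnectedOn.insert_adj [DecidableEq V] {Λ : Finset V} (h : ConnectedOn G Λ) {u v : V}
    (hu : u ∈ Λ) (huv : G.Adj u v) : ConnectedOn G (insert v Λ) := by
  have huv' : ConnectedOn G {u, v} := by
    rw [ConnectedOn, Finset.coe_pair]
    exact SimpleGraph.induce_pair_connected_of_adj huv
  have hunion : insert v Λ = Λ ∪ {u, v} := by
    ext x
    simp only [Finset.mem_insert, Finset.mem_union, Finset.mem_singleton]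
    grind
  exact hunion ▸ h.union huv' ⟨u, by simp [hu]⟩

theorem ConnectedOn.exists_path {Λ : Finset V} (h : ConnectedOn G Λ) {u v : V} (hu : u ∈ Λ)
    (hv : v ∈ Λ) : ∃ p : G.Walk u v, p.IsPath ∧ ∀ x ∈ p.support, x ∈ Λ := by
  obtain ⟨p, hp⟩ := h.exists_isPath ⟨u, hu⟩ ⟨v, hv⟩
  refine ⟨p.map (SimpleGraph.Embedding.induce (Λ : Set V)).toHom,
    hp.map Subtype.val_injective, fun x hx => ?_⟩
  obtain ⟨y, -, rfl⟩ := List.mem_map.1 (SimpleGraph.Walk.support_map _ p ▸ hx)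
  exact y.2

theorem exists_connectedOn_superset (hG : G.Connected) (S : Finset V) :
    ∃ Λ, S ⊆ Λ ∧ ConnectedOn G Λ := by
  classical
  induction S using Finset.induction_on with
  | empty =>
    obtain ⟨w⟩ := hG.nonempty
    exact ⟨{w}, Finset.empty_subset _, connectedOn_singleton w⟩
  | insert x S _ ih =>
    obtain ⟨Λ, hS, hΛ⟩ := ih
    obtain ⟨w, hw⟩ := hΛ.nonempty
    obtain ⟨p⟩ := hG.preconnected w x
    have hp : ConnectedOn G p.support.toFinset := by
      rw [ConnectedOn, List.coe_toFinset]
      exact p.connected_induce_support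
    refine ⟨Λ ∪ p.support.toFinset, ?_, hΛ.union hp ⟨w, ?_⟩⟩
    · exact Finset.insert_subset (by simp) (hS.trans Finset.subset_union_left)
    · exact Finset.mem_inter.2 ⟨hw, by simp⟩

theorem isPath_unique (hG : G.IsTree) {u v : V} {p q : G.Walk u v} (hp : p.IsPath)
    (hq : q.IsPath) : p = q :=
  (hG.existsUnique_path u v).unique hp hq

theorem length_eq_dist (hG : G.IsTree) {u v : V} {p : G.Walk u v} (hp : p.IsPath) :
    p.length = G.dist u v := by
  obtain ⟨q, hq, hl⟩ := hG.1.exists_path_of_dist u v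
  rw [isPath_unique hG hp hq, hl]

theorem ConnectedOn.eq_of_adj (hG : G.IsTree) {Λ : Finset V} (h : ConnectedOn G Λ) {u u' v : V}
    (hu : u ∈ Λ) (hu' : u' ∈ Λ) (hv : v ∉ Λ) (huv : G.Adj u v) (huv' : G.Adj u' v) :
    u = u' := by
  obtain ⟨p, hp, hs⟩ := h.exists_path hu hu'
  have hpath : (p.concat huv').IsPath := hp.concat (fun hmem => hv (hs _ hmem)) huv'
  have hedge : huv.toWalk.IsPath := by simpa using huv.ne
  have hlen := congrArg SimpleGraph.Walk.length (isPath_unique hG hpath hedge)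
  have hone : huv.toWalk.length = 1 := rfl
  rw [SimpleGraph.Walk.length_concat] at hlen
  exact SimpleGraph.Walk.eq_of_length_eq_zero (p := p) (by lia)

theorem ConnectedOn.oriented (hG : G.IsTree) {Λ : Finset V} (h : ConnectedOn G Λ) (hρ : ρ ∈ Λ)
    {u v : V} (hu : u ∈ Λ) (hv : v ∉ Λ) (huv : G.Adj u v) : Oriented G ρ (u, v) := by
  obtain ⟨p, hp, hs⟩ := h.exists_path hρ hu
  have hpath : (p.concat huv).IsPath := hp.concat (fun hmem => hv (hs _ hmem)) huv
  refine ⟨huv, ?_⟩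
  rw [← length_eq_dist hG hpath, ← length_eq_dist hG hp, SimpleGraph.Walk.length_concat]

theorem oriented_or_oriented_symm (hG : G.IsTree) (ρ : V) {x y : V} (h : G.Adj x y) :
    Oriented G ρ (x, y) ∨ Oriented G ρ (y, x) :=
  (hG.dist_eq_dist_add_one_of_adj ρ h).symm.imp (⟨h, ·⟩) (⟨h.symm, ·⟩)

theorem Oriented.not_symm {x y : V} (h : Oriented G ρ (x, y)) : ¬ Oriented G ρ (y, x) := by
  rintro ⟨-, h'⟩
  have := h.2
  lia

theorem existsUnique_oEdge (hG : G.IsTree) (ρ : V) {x y : V} (h : G.Adj x y) :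
    ∃! e : OEdge G ρ, e.1 = (x, y) ∨ e.1 = (y, x) := by
  rcases oriented_or_oriented_symm hG ρ h with hxy | hyx
  · refine ⟨⟨_, hxy⟩, .inl rfl, ?_⟩
    rintro ⟨_, he⟩ (rfl | rfl)
    exacts [rfl, absurd he hxy.not_symm]
  · refine ⟨⟨_, hyx⟩, .inr rfl, ?_⟩
    rintro ⟨_, he⟩ (rfl | rfl)
    exacts [absurd he hyx.not_symm, rfl]

theorem Oriented.isPath_concat (hG : G.IsTree) {x y : V} (h : Oriented G ρ (x, y))
    {p : G.Walk ρ x} (hp : p.IsPath) : (p.concat h.1).IsPath := by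
  classical
  refine hp.concat (fun (hy : y ∈ p.support) => ?_) h.1
  have := length_eq_dist hG (hp.takeUntil hy)
  have := p.length_takeUntil_le_length hy
  have := length_eq_dist hG hp
  have : G.dist ρ y = G.dist ρ x + 1 := h.2
  lia

theorem Oriented.eq_of_snd_eq (hG : G.IsTree) {x x' y : V} (h : Oriented G ρ (x, y))
    (h' : Oriented G ρ (x', y)) : x = x' := by
  obtain ⟨p, hp, -⟩ := hG.existsUnique_path ρ x
  obtain ⟨p', hp', -⟩ := hG.existsUnique_path ρ x'
  simpa using congrArg SimpleGraph.Walk.penultimate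
    (isPath_unique hG (h.isPath_concat hG hp) (h'.isPath_concat hG hp'))

theorem ConnectedOn.exists_oriented (hG : G.IsTree) {Λ : Finset V} (h : ConnectedOn G Λ)
    (hρ : ρ ∈ Λ) {x : V} (hx : x ∈ Λ) (hne : x ≠ ρ) : ∃ u ∈ Λ, Oriented G ρ (u, x) := by
  obtain ⟨p, hp, hs⟩ := h.exists_path hρ hx
  have hnil : ¬ p.Nil := SimpleGraph.Walk.not_nil_of_ne hne.symm
  have hadj := p.adj_penultimate hnil
  refine ⟨p.penultimate, hs _ (by simp), hadj, ?_⟩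
  rw [← length_eq_dist hG hp, ← length_eq_dist hG hp.dropLast,
    SimpleGraph.Walk.length_dropLast_add_one hnil]

theorem ConnectedOn.induction_oriented (hG : G.IsTree) {Λ : Finset V} (h : ConnectedOn G Λ)
    (hρ : ρ ∈ Λ) {P : V → Prop} (root : P ρ)
    (step : ∀ u ∈ Λ, ∀ v ∈ Λ, Oriented G ρ (u, v) → P u → P v) : ∀ x ∈ Λ, P x := by
  intro x hx
  induction hn : G.dist ρ x generalizing x with
  | zero => exact (hG.1.dist_eq_zero_iff.1 hn) ▸ root
  | succ n ih =>
    have hne : x ≠ ρ := by rintro rfl; simp at hn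
    obtain ⟨u, hu, hux⟩ := h.exists_oriented hG hρ hx hne
    have : G.dist ρ x = G.dist ρ u + 1 := hux.2
    exact step u hu x hx hux (ih u hu (by lia))

theorem stepGrad_of_oriented (ζ : GradConf G ρ) {x y : V} (h : Oriented G ρ (x, y)) :
    stepGrad ζ x y = ζ ⟨(x, y), h⟩ := dif_pos h

theorem stepGrad_grad (hG : G.IsTree) (ω : V → ℤ) {x y : V} (h : G.Adj x y) :
    stepGrad (grad G ρ ω) x y = ω y - ω x := by
  rcases oriented_or_oriented_symm hG ρ h with hxy | hyx
  · exact stepGrad_of_oriented _ hxy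
  · rw [stepGrad, dif_neg hyx.not_symm, dif_pos hyx, grad, neg_sub]

theorem pathSum_grad (hG : G.IsTree) (ω : V → ℤ) (x y : V) :
    pathSum hG (grad G ρ ω) x y = ω y - ω x := by
  have walkSum : ∀ {x y : V} (p : G.Walk x y),
      (p.darts.map fun d => stepGrad (grad G ρ ω) d.fst d.snd).sum = ω y - ω x := by
    intro x y p
    induction p with
    | nil => simp
    | cons h p ih => simp [ih, stepGrad_grad hG ω h]
  exact walkSum _

theorem heights_snd (hG : G.IsTree) (ζ : GradConf G ρ) (b : OEdge G ρ) :
    heights hG ζ b.1.2 = heights hG ζ b.1.1 + ζ b := by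
  obtain ⟨⟨x, y⟩, h⟩ := b
  have hpath := isPath_unique hG (hG.existsUnique_path ρ y).choose_spec.1
    (h.isPath_concat hG (hG.existsUnique_path ρ x).choose_spec.1)
  simp [heights, pathSum, hpath, stepGrad_of_oriented ζ h]

theorem grad_heights (hG : G.IsTree) (ζ : GradConf G ρ) : grad G ρ (heights hG ζ) = ζ :=
  funext fun b => sub_eq_iff_eq_add'.2 (heights_snd hG ζ b)

theorem grad_eq_grad_iff (hG : G.IsTree) {Λ : Finset V} (h : ConnectedOn G Λ) {ω ω' : V → ℤ} :
    (∀ b : OEdge G ρ, b.1.1 ∈ Λ → b.1.2 ∈ Λ → grad G ρ ω' b = grad G ρ ω b) ↔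
      ∃ c, ∀ x ∈ Λ, ω' x = ω x + c := by
  constructor
  · intro heq
    obtain ⟨w, hw⟩ := h.nonempty
    have hstep : ∀ {x y : V}, x ∈ Λ → y ∈ Λ → G.Adj x y → ω' y - ω' x = ω y - ω x := by
      intro x y hx hy hxy
      rcases oriented_or_oriented_symm hG ρ hxy with hor | hor
      · exact heq ⟨_, hor⟩ hx hy
      · have : ω' x - ω' y = ω x - ω y := heq ⟨_, hor⟩ hy hx
        lia
    refine ⟨ω' w - ω w, fun x hx => ?_⟩
    obtain ⟨p, -, hp⟩ := h.exists_path hx hw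
    clear hx
    induction p with
    | nil => ring
    | cons hadj p ih =>
      have := hstep (hp _ (by simp)) (hp _ (by simp)) hadj
      have := ih hw fun y hy => hp y (by simp [hy])
      lia
  · rintro ⟨c, hc⟩ b h1 h2
    simp only [grad, hc _ h1, hc _ h2]
    ring

end Tree

section Boundary

variable {V : Type*} {G : SimpleGraph V} [G.LocallyFinite] {ρ v : V} {Λ : Finset V}

theorem mem_outerBoundary {y : V} : y ∈ outerBoundary G Λ ↔ (∃ x ∈ Λ, G.Adj x y) ∧ y ∉ Λ := by
  simp [outerBoundary]

theorem mem_closureOf {y : V} : y ∈ closureOf G Λ ↔ y ∈ Λ ∨ ∃ x ∈ Λ, G.Adj x y := by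
  classical
  rw [closureOf, Finset.mem_union, mem_outerBoundary]
  tauto

theorem subset_closureOf (Λ : Finset V) : Λ ⊆ closureOf G Λ := by
  classical exact Finset.subset_union_left

theorem outerBoundary_subset_closureOf (Λ : Finset V) : outerBoundary G Λ ⊆ closureOf G Λ := by
  classical exact Finset.subset_union_right

theorem outerBoundary_singleton (v : V) : outerBoundary G {v} = G.neighborFinset v := by
  ext y
  simpa [mem_outerBoundary] using fun h : G.Adj v y => h.ne'

theorem edgesMeeting_mono {Λ' : Finset V} (h : Λ ⊆ Λ') :
    edgesMeeting G ρ Λ ⊆ edgesMeeting G ρ Λ' := fun b hb =>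
  (mem_edgesMeeting G ρ Λ' b).2 (((mem_edgesMeeting G ρ Λ b).1 hb).imp (@h _) (@h _))

theorem connectedOn_closureOf (h : ConnectedOn G Λ) : ConnectedOn G (closureOf G Λ) := by
  classical
  obtain ⟨w, hw⟩ := h.nonempty
  refine SimpleGraph.induce_connected_of_patches w (subset_closureOf _ hw) fun {x} hx => ?_
  rcases mem_closureOf.1 hx with hxΛ | ⟨u, hu, hux⟩
  · exact ⟨Λ, subset_closureOf _, hw, hxΛ, h.preconnected _ _⟩
  · have hΛx := h.insert_adj hu hux
    rw [ConnectedOn, Finset.coe_insert] at hΛx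
    exact ⟨insert x Λ, Set.insert_subset hx (subset_closureOf _), .inr hw, .inl rfl,
      hΛx.preconnected _ _⟩

theorem ConnectedOn.mem_edgesMeeting_iff (hG : G.IsTree) (h : ConnectedOn G Λ) (b : OEdge G ρ) :
    b ∈ edgesMeeting G ρ Λ ↔ b.1.1 ∈ closureOf G Λ ∧ b.1.2 ∈ closureOf G Λ := by
  classical
  have hb : G.Adj b.1.1 b.1.2 := b.2.1
  rw [mem_edgesMeeting]
  constructor
  · rintro (hfst | hsnd)
    · exact ⟨subset_closureOf _ hfst, mem_closureOf.2 (.inr ⟨_, hfst, hb⟩)⟩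
    · exact ⟨mem_closureOf.2 (.inr ⟨_, hsnd, hb.symm⟩), subset_closureOf _ hsnd⟩
  · rintro ⟨h₁, h₂⟩
    rw [mem_closureOf] at h₁ h₂
    by_contra! hnot
    obtain ⟨x, hx, hx₁⟩ := h₁.resolve_left hnot.1
    obtain ⟨y, hy, hy₂⟩ := h₂.resolve_left hnot.2
    have heq := (h.insert_adj hx hx₁).eq_of_adj hG (Finset.mem_insert_of_mem hy)
      (Finset.mem_insert_self _ _) (by simp [hnot.2, hb.ne']) hy₂ hb
    exact hnot.1 (heq ▸ hy)

theorem outerBoundary_insert [DecidableEq V] (v : V) (Λ : Finset V) :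
    outerBoundary G (insert v Λ) = (outerBoundary G Λ).erase v ∪ G.neighborFinset v \ Λ := by
  ext y
  have : G.Adj v y → y ≠ v := fun h => h.ne'
  simp only [mem_outerBoundary, Finset.mem_insert, Finset.mem_union, Finset.mem_erase,
    Finset.mem_sdiff, SimpleGraph.mem_neighborFinset]
  grind

theorem closureOf_insert [DecidableEq V] (hv : v ∈ closureOf G Λ) :
    closureOf G (insert v Λ) = closureOf G Λ ∪ G.neighborFinset v \ Λ := by
  ext y
  rw [mem_closureOf] at hv
  simp only [mem_closureOf, Finset.mem_insert, Finset.mem_union, Finset.mem_sdiff,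
    SimpleGraph.mem_neighborFinset]
  grind

theorem ConnectedOn.disjoint_closureOf [DecidableEq V] (hG : G.IsTree) (h : ConnectedOn G Λ)
    (hv : v ∈ outerBoundary G Λ) :
    Disjoint (closureOf G Λ) (G.neighborFinset v \ Λ) := by
  obtain ⟨⟨u, hu, huv⟩, hvΛ⟩ := mem_outerBoundary.1 hv
  refine Finset.disjoint_right.2 fun y hy hyΛ => ?_
  rw [Finset.mem_sdiff, SimpleGraph.mem_neighborFinset] at hy
  obtain ⟨x, hx, hxy⟩ := (mem_closureOf.1 hyΛ).resolve_left hy.2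
  have heq := (h.insert_adj hu huv).eq_of_adj hG (Finset.mem_insert_of_mem hx)
    (Finset.mem_insert_self _ _) (by simp [hy.2, hy.1.ne']) hxy hy.1
  exact hvΛ (heq ▸ hx)

theorem ConnectedOn.card_neighborFinset_sdiff [DecidableEq V] (hG : G.IsTree)
    (h : ConnectedOn G Λ) (hv : v ∈ outerBoundary G Λ) :
    (G.neighborFinset v \ Λ).card + 1 = G.degree v := by
  obtain ⟨⟨u, hu, huv⟩, hvΛ⟩ := mem_outerBoundary.1 hv
  have hinter : G.neighborFinset v ∩ Λ = {u} := by
    ext x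
    rw [Finset.mem_inter, SimpleGraph.mem_neighborFinset, Finset.mem_singleton]
    exact ⟨fun hx => h.eq_of_adj hG hx.2 hu hvΛ hx.1.symm huv,
      by rintro rfl; exact ⟨huv.symm, hu⟩⟩
  rw [← SimpleGraph.card_neighborFinset_eq_degree,
    ← Finset.card_sdiff_add_card_inter (G.neighborFinset v) Λ, hinter, Finset.card_singleton]

theorem outerBoundary_nonempty [Infinite V] (hG : G.Connected) (hΛ : Λ.Nonempty) :
    (outerBoundary G Λ).Nonempty := by
  obtain ⟨w, hw⟩ := hΛ
  obtain ⟨x, hx⟩ := Infinite.exists_notMem_finset Λ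
  obtain ⟨p⟩ := hG.preconnected w x
  obtain ⟨d, -, hfst, hsnd⟩ := p.exists_boundary_dart Λ hw hx
  exact ⟨d.snd, mem_outerBoundary.2 ⟨⟨d.fst, hfst, d.adj⟩, hsnd⟩⟩

theorem infinite_of_two_le_degree (hG : G.IsTree) (hdeg : ∀ v, 2 ≤ G.degree v) : Infinite V := by
  by_contra hfin
  rw [not_infinite_iff_finite] at hfin
  obtain ⟨w⟩ := hG.1.nonempty
  obtain ⟨x, hx⟩ := (G.degree_pos_iff_exists_adj w).1 (by linarith [hdeg w])
  have : Nontrivial V := ⟨w, x, hx.ne⟩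
  obtain ⟨u, -, -, hu, -⟩ := hG.exists_ne_and_degree_eq_one
  linarith [hdeg u]

theorem ConnectedOn.growth [DecidableEq V] {Λ₀ Λ₁ : Finset V} (h₀ : ConnectedOn G Λ₀)
    (h₁ : ConnectedOn G Λ₁) (hsub : Λ₀ ⊆ Λ₁) {P : Finset V → Prop} (base : P Λ₀)
    (step : ∀ Λ, Λ₀ ⊆ Λ → ConnectedOn G Λ → ∀ v ∈ outerBoundary G Λ, P Λ → P (insert v Λ)) :
    P Λ₁ := by
  suffices H : ∀ Λ, Λ₀ ⊆ Λ → Λ ⊆ Λ₁ → ConnectedOn G Λ → P Λ → P Λ₁ from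
    H Λ₀ subset_rfl hsub h₀ base
  intro Λ
  induction hn : (Λ₁ \ Λ).card generalizing Λ with
  | zero =>
    intro _ hΛ₁ _ hP
    exact hΛ₁.antisymm (Finset.sdiff_eq_empty_iff_subset.1 (Finset.card_eq_zero.1 hn)) ▸ hP
  | succ n ih =>
    intro hΛ₀ hΛ₁ hΛ hP
    obtain ⟨x, hx⟩ : (Λ₁ \ Λ).Nonempty := Finset.card_pos.1 (by lia)
    rw [Finset.mem_sdiff] at hx
    obtain ⟨w, hw⟩ := hΛ.nonempty
    obtain ⟨p, -, hp⟩ := h₁.exists_path (hΛ₁ hw) hx.1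
    obtain ⟨d, hd, hfst, hsnd⟩ := p.exists_boundary_dart Λ hw hx.2
    have hsnd₁ : d.snd ∈ Λ₁ := hp _ (p.dart_snd_mem_support_of_mem_darts hd)
    refine ih (insert d.snd Λ) ?_ (hΛ₀.trans (Finset.subset_insert _ _))
      (Finset.insert_subset hsnd₁ hΛ₁) (hΛ.insert_adj hfst d.adj)
      (step Λ hΛ₀ hΛ d.snd (mem_outerBoundary.2 ⟨⟨_, hfst, d.adj⟩, hsnd⟩) hP)
    rw [Finset.sdiff_insert, Finset.card_erase_of_mem (Finset.mem_sdiff.2 ⟨hsnd₁, hsnd⟩), hn,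
      Nat.add_sub_cancel]

theorem prod_edgesMeeting_insert [DecidableEq V] (hG : G.IsTree) {M : Type*} [CommMonoid M]
    (hv : v ∉ Λ) (g : OEdge G ρ → M) (F : V → M)
    (hF : ∀ e : OEdge G ρ, ∀ y ∉ Λ, e.1 = (v, y) ∨ e.1 = (y, v) → g e = F y) :
    ∏ e ∈ edgesMeeting G ρ (insert v Λ), g e =
      (∏ e ∈ edgesMeeting G ρ Λ, g e) * ∏ y ∈ G.neighborFinset v \ Λ, F y := by
  classical
  rw [← Finset.prod_sdiff (edgesMeeting_mono (Finset.subset_insert v Λ)), mul_comm]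
  congr 1
  have hadj : ∀ y ∈ G.neighborFinset v \ Λ, G.Adj v y := fun y hy =>
    (SimpleGraph.mem_neighborFinset _ _ _).1 (Finset.mem_sdiff.1 hy).1
  symm
  refine Finset.prod_bij (fun y hy => (existsUnique_oEdge hG ρ (hadj y hy)).choose)
    (fun y hy => ?_) (fun y hy y' hy' heq => ?_) (fun e he => ?_) (fun y hy => ?_)
  · have hends := (existsUnique_oEdge hG ρ (hadj y hy)).choose_spec.1
    simp only [Finset.mem_sdiff, mem_edgesMeeting, Finset.mem_insert] at hy ⊢
    grind
  · have hends := (existsUnique_oEdge hG ρ (hadj y hy)).choose_spec.1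
    have hends' := (existsUnique_oEdge hG ρ (hadj y' hy')).choose_spec.1
    have := (hadj y hy).ne
    simp only [heq] at hends
    grind
  · simp only [Finset.mem_sdiff, mem_edgesMeeting, Finset.mem_insert, not_or] at he
    obtain ⟨y, hy, hends⟩ : ∃ y ∈ G.neighborFinset v \ Λ, e.1 = (v, y) ∨ e.1 = (y, v) := by
      obtain ⟨⟨x, y⟩, hxy⟩ := e
      have hadj : G.Adj x y := hxy.1
      simp only [Finset.mem_sdiff, SimpleGraph.mem_neighborFinset]
      grind [hadj.symm]
    have hunique := existsUnique_oEdge hG ρ (hadj y hy)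
    exact ⟨y, hy, hunique.unique hunique.choose_spec.1 hends⟩
  · exact (hF _ y (Finset.mem_sdiff.1 hy).2
      (existsUnique_oEdge hG ρ (hadj y hy)).choose_spec.1).symm

end Boundary

section Summation

theorem hasSum_prod_fin {κ : Type*} {n : ℕ} {f : Fin n → κ → ℝ} {a : Fin n → ℝ}
    (hf : ∀ i, 0 ≤ f i) (h : ∀ i, HasSum (f i) (a i)) :
    HasSum (fun x : Fin n → κ => ∏ i, f i (x i)) (∏ i, a i) := by
  induction n with
  | zero => simp
  | succ n ih =>
    have htail := ih (fun i => hf i.succ) fun i => h i.succ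
    have htail_nonneg : 0 ≤ fun x : Fin n → κ => ∏ i, f i.succ (x i) := fun x =>
      Finset.prod_nonneg fun i _ => hf _ _
    have hmul := (h 0).summable.mul_of_nonneg htail.summable (hf 0) htail_nonneg
    rw [Fin.prod_univ_succ, ← (Fin.consEquiv fun _ => κ).hasSum_iff]
    exact ((h 0).mul htail hmul).congr_fun fun x => by simp [Fin.prod_univ_succ]

theorem hasSum_prod_pi {ι κ : Type*} [Fintype ι] {f : ι → κ → ℝ} {a : ι → ℝ}
    (hf : ∀ i, 0 ≤ f i) (h : ∀ i, HasSum (f i) (a i)) :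
    HasSum (fun x : ι → κ => ∏ i, f i (x i)) (∏ i, a i) := by
  let e := (Fintype.equivFin ι).symm
  have hsum := hasSum_prod_fin (fun i => hf (e i)) fun i => h (e i)
  rw [e.prod_comp, ← (e.symm.arrowCongr (Equiv.refl κ)).hasSum_iff] at hsum
  exact hsum.congr_fun fun x => (e.prod_comp fun i => f i (x i)).symm

theorem sum_range_add_of_periodic {M : Type*} [AddCancelCommMonoid M] {q : ℕ} {f : ℤ → M}
    (hf : Function.Periodic f q) (t : ℤ) :
    ∑ s ∈ Finset.range q, f (s + t) = ∑ s ∈ Finset.range q, f s := by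
  have hone : Function.Periodic (fun t : ℤ => ∑ s ∈ Finset.range q, f (s + t)) 1 := fun t => by
    have hshift := (Finset.sum_range_succ' (fun s : ℕ => f (s + t)) q).symm.trans
      (Finset.sum_range_succ (fun s : ℕ => f (s + t)) q)
    have hwrap : f (q + t) = f (((0 : ℕ) : ℤ) + t) := by rw [add_comm, hf, Nat.cast_zero, zero_add]
    rw [hwrap] at hshift
    simpa [add_assoc, add_comm (1 : ℤ)] using add_right_cancel hshift
  simpa using hone.int_mul_eq t

end Summation

section Marginals

variable {V : Type*} {G : SimpleGraph V} {ρ : V} {β : ℝ} {q k : ℕ} {l : ℤ → ℝ}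

/-- The convolution of `l` with the transfer operator, the sum in the boundary-law equation. -/
def conv (β : ℝ) (l : ℤ → ℝ) (i : ℤ) : ℝ := ∑' j : ℤ, Q β (i - j) * l j

theorem Q_neg (β : ℝ) (m : ℤ) : Q β (-m) = Q β m := by simp [Q]

theorem Q_pos (β : ℝ) (m : ℤ) : 0 < Q β m := Real.exp_pos _

theorem Q_grad {e : OEdge G ρ} {x y : V} (h : e.1 = (x, y) ∨ e.1 = (y, x)) (ω : V → ℤ) :
    Q β (grad G ρ ω e) = Q β (ω y - ω x) := by
  rcases h with h | h
  · simp [grad, h]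
  · rw [← Q_neg]
    simp [grad, h]

theorem conv_pos (hl : ∀ i, 0 < l i) (hs : ∀ i, Summable fun j => Q β (i - j) * l j) (i : ℤ) :
    0 < conv β l i :=
  (hs i).tsum_pos (fun j => (mul_pos (Q_pos _ _) (hl j)).le) i (mul_pos (Q_pos _ _) (hl i))

theorem IsBoundaryLaw.conv_pos (h : IsBoundaryLaw β k l) (i : ℤ) : 0 < conv β l i :=
  SOS.conv_pos h.1 h.2.1 i

theorem IsBoundaryLaw.hasSum (h : IsBoundaryLaw β k l) (i s : ℤ) :
    HasSum (fun j => Q β (j - i) * l (s + j)) (conv β l (s + i)) := by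
  have hsum := (h.2.1 (s + i)).hasSum
  rw [← (Equiv.addLeft s).hasSum_iff] at hsum
  refine hsum.congr_fun fun j => ?_
  rw [Function.comp_apply, Equiv.coe_addLeft, add_sub_add_left_eq_sub, ← Q_neg, neg_sub]

theorem glue_of_mem {S : Finset V} (σ : S → ℤ) (ω : V → ℤ) {x : V} (hx : x ∈ S) :
    glue S σ ω x = σ ⟨x, hx⟩ := dif_pos hx

theorem glue_of_notMem {S : Finset V} (σ : S → ℤ) (ω : V → ℤ) {x : V} (hx : x ∉ S) :
    glue S σ ω x = ω x := dif_neg hx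

/-- The sum over a period in the marginals of the measure assigned to `l`, in terms of a height
configuration instead of its gradient field; `S` is the outer boundary of the volume. -/
def boundarySum (q : ℕ) (l : ℤ → ℝ) (S : Finset V) (ω : V → ℤ) : ℝ :=
  ∑ s ∈ Finset.range q, ∏ y ∈ S, l (s + ω y)

theorem boundarySum_pos (hq : q ≠ 0) (hl : ∀ i, 0 < l i) (S : Finset V) (ω : V → ℤ) :
    0 < boundarySum q l S ω :=
  Finset.sum_pos (fun _ _ => Finset.prod_pos fun _ _ => hl _) (Finset.nonempty_range_iff.2 hq)

theorem boundarySum_congr {S : Finset V} {ω ω' : V → ℤ} (h : ∀ y ∈ S, ω' y = ω y) :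
    boundarySum q l S ω' = boundarySum q l S ω :=
  Finset.sum_congr rfl fun _ _ => Finset.prod_congr rfl fun y hy => by rw [h y hy]

theorem boundarySum_add_const (hl : Function.Periodic l q) (S : Finset V) (ω : V → ℤ) (t : ℤ) :
    boundarySum q l S (fun y => ω y + t) = boundarySum q l S ω := by
  have hper : Function.Periodic (fun n => ∏ y ∈ S, l (n + ω y)) q := fun n =>
    Finset.prod_congr rfl fun y _ => by rw [add_right_comm, hl]
  rw [boundarySum, boundarySum, ← sum_range_add_of_periodic hper t]
  exact Finset.sum_congr rfl fun s _ => Finset.prod_congr rfl fun y _ => by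
    rw [add_assoc, add_comm t]

variable [G.LocallyFinite]

/-- The event that the gradient configuration agrees with `ζ` on the edges meeting `Λ`. -/
def cyl (Λ : Finset V) (ζ : GradConf G ρ) : Set (GradConf G ρ) :=
  {η | ∀ b ∈ edgesMeeting G ρ Λ, η b = ζ b}

/-- The marginal of the measure assigned to `l` on the edges meeting `Λ`, up to the normalising
constant, at the gradient field of `ω`. -/
def weight (G : SimpleGraph V) [G.LocallyFinite] (ρ : V) (β : ℝ) (q : ℕ) (l : ℤ → ℝ)
    (Λ : Finset V) (ω : V → ℤ) : ℝ :=
  boundarySum q l (outerBoundary G Λ) ω * ∏ b ∈ edgesMeeting G ρ Λ, Q β (grad G ρ ω b)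

/-- The condition of `HasMarginals` for a single volume `Λ`, in terms of height configurations. -/
def HasMarginalOn (β : ℝ) (q : ℕ) (l : ℤ → ℝ) (ν : Measure (GradConf G ρ)) (Λ : Finset V) :
    Prop :=
  ∃ Z : ℝ, 0 < Z ∧ ∀ ω : V → ℤ,
    ν (cyl Λ (grad G ρ ω)) = ENNReal.ofReal (Z * weight G ρ β q l Λ ω)

theorem weight_nonneg (hl : ∀ i, 0 < l i) (Λ : Finset V) (ω : V → ℤ) :
    0 ≤ weight G ρ β q l Λ ω :=
  mul_nonneg (Finset.sum_nonneg fun _ _ => Finset.prod_nonneg fun _ _ => (hl _).le)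
    (Finset.prod_nonneg fun _ _ => (Q_pos _ _).le)

theorem cyl_eq_preimage (Λ : Finset V) (ζ : GradConf G ρ) :
    cyl Λ ζ = (edgesMeeting G ρ Λ).restrict (π := fun _ => ℤ) ⁻¹'
      {(edgesMeeting G ρ Λ).restrict ζ} := by
  ext η
  simp [cyl, funext_iff]

theorem measurableSet_cyl (Λ : Finset V) (ζ : GradConf G ρ) : MeasurableSet (cyl Λ ζ) := by
  rw [cyl_eq_preimage]
  exact Finset.measurable_restrict _ (measurableSet_singleton _)

theorem map_restrict_eq_of_cyl (hG : G.IsTree) {μ ν : Measure (GradConf G ρ)} {Λ : Finset V}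
    (h : ∀ ω, μ (cyl Λ (grad G ρ ω)) = ν (cyl Λ (grad G ρ ω))) :
    μ.map (edgesMeeting G ρ Λ).restrict = ν.map (edgesMeeting G ρ Λ).restrict := by
  refine Measure.ext_of_singleton fun e => ?_
  obtain ⟨ζ, rfl⟩ := Subtype.surjective_restrict (β := fun _ => ℤ) (· ∈ edgesMeeting G ρ Λ) e
  have hcyl := h (heights hG ζ)
  rw [grad_heights, cyl_eq_preimage] at hcyl
  rwa [Measure.map_apply (Finset.measurable_restrict _) (measurableSet_singleton _),
    Measure.map_apply (Finset.measurable_restrict _) (measurableSet_singleton _)]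

theorem measure_ext_of_cyl (hG : G.IsTree) {μ ν : Measure (GradConf G ρ)} [IsFiniteMeasure ν]
    {Λ₀ : Finset V} (h : ∀ Λ, Λ₀ ⊆ Λ → ConnectedOn G Λ → ∀ ω,
      μ (cyl Λ (grad G ρ ω)) = ν (cyl Λ (grad G ρ ω))) : μ = ν := by
  classical
  refine IsProjectiveLimit.unique (P := fun I => ν.map I.restrict) (fun I => ?_) (fun I => rfl)
  obtain ⟨Λ, hΛ₀, hΛ⟩ := exists_connectedOn_superset hG.1 (Λ₀ ∪ I.image fun b => b.1.1)
  rw [Finset.union_subset_iff] at hΛ₀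
  have hI : I ⊆ edgesMeeting G ρ Λ := fun b hb =>
    (mem_edgesMeeting G ρ Λ b).2 (.inl (hΛ₀.2 (Finset.mem_image_of_mem _ hb)))
  rw [← Finset.restrict₂_comp_restrict hI, ← Measure.map_map (by fun_prop) (by fun_prop),
    map_restrict_eq_of_cyl hG (h Λ hΛ₀.1 hΛ),
    Measure.map_map (by fun_prop) (by fun_prop), Finset.restrict₂_comp_restrict]

theorem mem_cyl_grad_iff (hG : G.IsTree) {Λ : Finset V} (hΛ : ConnectedOn G Λ)
    {η : GradConf G ρ} {ω : V → ℤ} :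
    η ∈ cyl Λ (grad G ρ ω) ↔ ∃ c, ∀ x ∈ closureOf G Λ, heights hG η x = ω x + c := by
  rw [← grad_eq_grad_iff (ρ := ρ) hG (connectedOn_closureOf hΛ), grad_heights]
  simp only [cyl, Set.mem_ofPred_eq, hΛ.mem_edgesMeeting_iff hG, and_imp]

theorem mem_iUnion_cyl_glue_iff [DecidableEq V] (hG : G.IsTree) {Λ : Finset V}
    (hΛ : ConnectedOn G Λ) (S : Finset V) {η : GradConf G ρ} {ω : V → ℤ} :
    η ∈ ⋃ σ : S → ℤ, cyl Λ (grad G ρ (glue S σ ω)) ↔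
      ∃ c, ∀ x ∈ closureOf G Λ \ S, heights hG η x = ω x + c := by
  simp only [Set.mem_iUnion, mem_cyl_grad_iff hG hΛ]
  constructor
  · rintro ⟨σ, c, hc⟩
    refine ⟨c, fun x hx => ?_⟩
    rw [Finset.mem_sdiff] at hx
    rw [hc x hx.1, glue_of_notMem σ ω hx.2]
  · rintro ⟨c, hc⟩
    refine ⟨fun x => heights hG η x - c, c, fun x hx => ?_⟩
    by_cases hxS : x ∈ S
    · rw [glue_of_mem _ _ hxS, sub_add_cancel]
    · rw [glue_of_notMem _ _ hxS, hc x (Finset.mem_sdiff.2 ⟨hx, hxS⟩)]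

theorem pairwise_disjoint_cyl_glue (hG : G.IsTree) {Λ S : Finset V} (hΛ : ConnectedOn G Λ)
    (hS : S ⊂ closureOf G Λ) (ω : V → ℤ) :
    Pairwise (Function.onFun Disjoint fun σ : S → ℤ => cyl Λ (grad G ρ (glue S σ ω))) := by
  intro σ τ hne
  refine Set.disjoint_left.2 fun η hσ hτ => hne (funext fun x => ?_)
  obtain ⟨c, hc⟩ := (mem_cyl_grad_iff hG hΛ).1 hσ
  obtain ⟨d, hd⟩ := (mem_cyl_grad_iff hG hΛ).1 hτ
  obtain ⟨w, hw, hwS⟩ := Finset.exists_of_ssubset hS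
  have hcw := hc w hw
  have hdw := hd w hw
  have hcx := hc x (hS.1 x.2)
  have hdx := hd x (hS.1 x.2)
  rw [glue_of_notMem _ _ hwS] at hcw hdw
  rw [glue_of_mem _ _ x.2] at hcx hdx
  lia

theorem hasMarginals_iff (hG : G.IsTree) (hl : Function.Periodic l q)
    (ν : Measure (GradConf G ρ)) :
    HasMarginals hG ρ β q l ν ↔ ∀ Λ, ConnectedOn G Λ → HasMarginalOn β q l ν Λ := by
  refine forall₂_congr fun Λ (hΛ : ConnectedOn G Λ) => exists_congr fun Z =>
    and_congr_right fun _ => ?_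
  have hcyl : ∀ ζ : GradConf G ρ, {η : GradConf G ρ | ∀ b : OEdge G ρ, b.1.1 ∈ closureOf G Λ →
      b.1.2 ∈ closureOf G Λ → η b = ζ b} = cyl Λ ζ := fun ζ => by
    simp only [cyl, hΛ.mem_edgesMeeting_iff hG, and_imp]
  have hsum : ∀ w (ω : V → ℤ), ∑ s ∈ Finset.range q, ∏ y ∈ outerBoundary G Λ,
      l (s + pathSum hG (grad G ρ ω) w y) = boundarySum q l (outerBoundary G Λ) ω := by
    intro w ω
    simp only [pathSum_grad, sub_eq_add_neg]
    exact boundarySum_add_const hl _ ω (-ω w)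
  simp only [hcyl, weight, ← mul_assoc]
  constructor
  · intro H ω
    obtain ⟨w, hw⟩ := hΛ.nonempty
    rw [H w hw, hsum]
  · intro H w _ ζ
    have hζ := H (heights hG ζ)
    rwa [← hsum w, grad_heights] at hζ

end Marginals

section Growth

variable {V : Type*} {G : SimpleGraph V} [G.LocallyFinite] {ρ v : V} {β : ℝ} {q k : ℕ} {l : ℤ → ℝ}
  {Λ : Finset V}

section Insert

variable [DecidableEq V]

theorem cyl_eq_iUnion_insert (hG : G.IsTree) (hΛ : ConnectedOn G Λ)
    (hv : v ∈ outerBoundary G Λ) (ω : V → ℤ) :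
    cyl Λ (grad G ρ ω) = ⋃ σ : ↥(G.neighborFinset v \ Λ) → ℤ,
      cyl (insert v Λ) (grad G ρ (glue (G.neighborFinset v \ Λ) σ ω)) := by
  obtain ⟨⟨u, hu, huv⟩, -⟩ := mem_outerBoundary.1 hv
  ext η
  rw [mem_iUnion_cyl_glue_iff hG (hΛ.insert_adj hu huv), mem_cyl_grad_iff hG hΛ,
    closureOf_insert (outerBoundary_subset_closureOf Λ hv),
    Finset.union_sdiff_cancel_right (hΛ.disjoint_closureOf hG hv)]

theorem glue_neighborFinset_sdiff (hG : G.IsTree) (hΛ : ConnectedOn G Λ)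
    (hv : v ∈ outerBoundary G Λ) (ω : V → ℤ) (σ : ↥(G.neighborFinset v \ Λ) → ℤ) {x : V}
    (hx : x ∈ closureOf G Λ) : glue _ σ ω x = ω x :=
  glue_of_notMem σ ω (Finset.disjoint_left.1 (hΛ.disjoint_closureOf hG hv) hx)

theorem prod_Q_insert_glue (hG : G.IsTree) (hΛ : ConnectedOn G Λ) (hv : v ∈ outerBoundary G Λ)
    (ω : V → ℤ) (σ : ↥(G.neighborFinset v \ Λ) → ℤ) :
    ∏ b ∈ edgesMeeting G ρ (insert v Λ), Q β (grad G ρ (glue _ σ ω) b) =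
      (∏ b ∈ edgesMeeting G ρ Λ, Q β (grad G ρ ω b)) * ∏ y, Q β (σ y - ω v) := by
  have hglue := fun x (hx : x ∈ closureOf G Λ) => glue_neighborFinset_sdiff hG hΛ hv ω σ hx
  rw [prod_edgesMeeting_insert hG (mem_outerBoundary.1 hv).2 _
    (fun y => Q β (glue _ σ ω y - ω v)) fun e y _ he => by
      rw [Q_grad he, hglue v (outerBoundary_subset_closureOf Λ hv)],
    ← Finset.prod_coe_sort (G.neighborFinset v \ Λ)]
  congr 1
  · refine Finset.prod_congr rfl fun b hb => ?_
    obtain ⟨h₁, h₂⟩ := (hΛ.mem_edgesMeeting_iff hG b).1 hb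
    rw [grad, grad, hglue _ h₁, hglue _ h₂]
  · exact Finset.prod_congr rfl fun y _ => by rw [glue_of_mem σ ω y.2]

theorem prod_outerBoundary_insert_glue (hG : G.IsTree) (hΛ : ConnectedOn G Λ)
    (hv : v ∈ outerBoundary G Λ) (ω : V → ℤ) (σ : ↥(G.neighborFinset v \ Λ) → ℤ) (s : ℤ) :
    ∏ y ∈ outerBoundary G (insert v Λ), l (s + glue _ σ ω y) =
      (∏ y ∈ (outerBoundary G Λ).erase v, l (s + ω y)) * ∏ y, l (s + σ y) := by
  have herase : (outerBoundary G Λ).erase v ⊆ closureOf G Λ :=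
    (Finset.erase_subset _ _).trans (outerBoundary_subset_closureOf Λ)
  rw [outerBoundary_insert, Finset.prod_union ((hΛ.disjoint_closureOf hG hv).mono_left herase),
    ← Finset.prod_coe_sort (G.neighborFinset v \ Λ)]
  congr 1
  · exact Finset.prod_congr rfl fun y hy => by
      rw [glue_neighborFinset_sdiff hG hΛ hv ω σ (herase hy)]
  · exact Finset.prod_congr rfl fun y _ => by rw [glue_of_mem σ ω y.2]

theorem weight_insert_glue (hG : G.IsTree) (hΛ : ConnectedOn G Λ) (hv : v ∈ outerBoundary G Λ)
    (ω : V → ℤ) (σ : ↥(G.neighborFinset v \ Λ) → ℤ) :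
    weight G ρ β q l (insert v Λ) (glue _ σ ω) =
      (∑ s ∈ Finset.range q, (∏ y ∈ (outerBoundary G Λ).erase v, l (s + ω y)) *
        ∏ y, Q β (σ y - ω v) * l (s + σ y)) * ∏ b ∈ edgesMeeting G ρ Λ, Q β (grad G ρ ω b) := by
  rw [weight, boundarySum, prod_Q_insert_glue hG hΛ hv, Finset.sum_mul, Finset.sum_mul]
  refine Finset.sum_congr rfl fun s _ => ?_
  rw [prod_outerBoundary_insert_glue hG hΛ hv, Finset.prod_mul_distrib]
  ring

theorem hasSum_weight_insert (hG : G.IsTree) (hdeg : G.IsRegularOfDegree (k + 1))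
    (hΛ : ConnectedOn G Λ) (hv : v ∈ outerBoundary G Λ) (hl : IsBoundaryLaw β k l) {c : ℝ}
    (hc : c ≠ 0) (hlc : ∀ i, l i = c * conv β l i ^ k) (ω : V → ℤ) :
    HasSum (fun σ : ↥(G.neighborFinset v \ Λ) → ℤ => weight G ρ β q l (insert v Λ) (glue _ σ ω))
      (c⁻¹ * weight G ρ β q l Λ ω) := by
  simp only [weight_insert_glue hG hΛ hv]
  have hcard : (G.neighborFinset v \ Λ).card = k := by
    have := hΛ.card_neighborFinset_sdiff hG hv
    have := hdeg v
    lia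
  have hnew : ∀ s : ℤ, HasSum (fun σ : ↥(G.neighborFinset v \ Λ) → ℤ =>
      ∏ y, Q β (σ y - ω v) * l (s + σ y)) (c⁻¹ * l (s + ω v)) := by
    intro s
    have hprod := hasSum_prod_pi (ι := ↥(G.neighborFinset v \ Λ))
      (f := fun _ j => Q β (j - ω v) * l (s + j))
      (fun _ j => (mul_pos (Q_pos β (j - ω v)) (hl.1 (s + j))).le) fun _ => hl.hasSum (ω v) s
    rwa [Finset.prod_const, Finset.card_univ, Fintype.card_coe, hcard,
      ← inv_mul_cancel_left₀ hc (conv β l (s + ω v) ^ k), ← hlc] at hprod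
  have hsum : c⁻¹ * weight G ρ β q l Λ ω =
      (∑ s ∈ Finset.range q, (∏ y ∈ (outerBoundary G Λ).erase v, l (s + ω y)) *
        (c⁻¹ * l (s + ω v))) * ∏ b ∈ edgesMeeting G ρ Λ, Q β (grad G ρ ω b) := by
    rw [weight, boundarySum, ← mul_assoc, Finset.mul_sum]
    congr 1
    refine Finset.sum_congr rfl fun s _ => ?_
    rw [← Finset.prod_erase_mul _ _ hv, mul_left_comm]
  rw [hsum]
  refine HasSum.mul_right _ (hasSum_sum fun s _ => ?_)
  exact (hnew s).mul_left _

theorem HasMarginalOn.of_insert (hG : G.IsTree) (hdeg : G.IsRegularOfDegree (k + 1))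
    (hΛ : ConnectedOn G Λ) (hv : v ∈ outerBoundary G Λ) (hl : IsBoundaryLaw β k l)
    {ν : Measure (GradConf G ρ)} (h : HasMarginalOn β q l ν (insert v Λ)) :
    HasMarginalOn β q l ν Λ := by
  obtain ⟨c, hc, hlc⟩ := hl.2.2
  obtain ⟨Z, hZ, H⟩ := h
  refine ⟨Z * c⁻¹, by positivity, fun ω => ?_⟩
  obtain ⟨⟨u, hu, huv⟩, -⟩ := mem_outerBoundary.1 hv
  have hN : G.neighborFinset v \ Λ ⊂ closureOf G (insert v Λ) := by
    rw [closureOf_insert (outerBoundary_subset_closureOf Λ hv)]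
    refine Finset.ssubset_iff_subset_ne.2 ⟨Finset.subset_union_right, fun heq => ?_⟩
    have hv' := Finset.mem_union_left (G.neighborFinset v \ Λ) (outerBoundary_subset_closureOf Λ hv)
    simp [← heq] at hv'
  have hsum := (hasSum_weight_insert (ρ := ρ) (q := q) hG hdeg hΛ hv hl hc.ne' hlc ω).mul_left Z
  rw [cyl_eq_iUnion_insert hG hΛ hv, measure_iUnion
    (pairwise_disjoint_cyl_glue hG (hΛ.insert_adj hu huv) hN ω) fun _ => measurableSet_cyl _ _]
  simp only [H]
  rw [← ENNReal.ofReal_tsum_of_nonneg (fun σ => mul_nonneg hZ.le (weight_nonneg hl.1 _ _))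
    hsum.summable, hsum.tsum_eq, mul_assoc]

end Insert

theorem HasMarginalOn.of_subset (hG : G.IsTree) (hdeg : G.IsRegularOfDegree (k + 1))
    {Λ' : Finset V} (hΛ : ConnectedOn G Λ) (hΛ' : ConnectedOn G Λ') (hsub : Λ ⊆ Λ')
    (hl : IsBoundaryLaw β k l) {ν : Measure (GradConf G ρ)} (h : HasMarginalOn β q l ν Λ') :
    HasMarginalOn β q l ν Λ := by
  classical
  exact hΛ.growth hΛ' hsub (P := fun Λ₁ => HasMarginalOn β q l ν Λ₁ → HasMarginalOn β q l ν Λ) id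
    (fun Λ₁ _ hΛ₁ v hv ih hmarg => ih (hmarg.of_insert hG hdeg hΛ₁ hv hl)) h

end Growth

section Construction

variable {V : Type*} {G : SimpleGraph V} {ρ : V} {β : ℝ} {q k : ℕ} {l : ℤ → ℝ} {Λ : Finset V}

/-- The law of the increment along an edge of the Markov chain with boundary law `l`, when the
chain has height `i` at the start of the edge. -/
def stepPMF (hl : IsBoundaryLaw β k l) (i : ℤ) : PMF ℤ :=
  ⟨fun j => ENNReal.ofReal (Q β j * l (i + j) / conv β l i), by
    have hsum : HasSum (fun j => Q β j * l (i + j) / conv β l i) 1 := by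
      simpa [(hl.conv_pos i).ne'] using (hl.hasSum 0 i).div_const (conv β l i)
    have hnonneg : ∀ j, 0 ≤ Q β j * l (i + j) / conv β l i := fun j =>
      div_nonneg (mul_pos (Q_pos _ _) (hl.1 _)).le (hl.conv_pos i).le
    rw [ENNReal.summable.hasSum_iff, ← ENNReal.ofReal_tsum_of_nonneg hnonneg hsum.summable,
      hsum.tsum_eq, ENNReal.ofReal_one]⟩

/-- The law of a family of independent increments, one for each vertex and each height of its
parent. -/
def incrementLaw (V : Type*) (hl : IsBoundaryLaw β k l) : Measure (V × ℤ → ℤ) :=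
  Measure.infinitePi fun i => (stepPMF hl i.2).toMeasure

instance (hl : IsBoundaryLaw β k l) : IsProbabilityMeasure (incrementLaw V hl) := by
  unfold incrementLaw
  infer_instance

/-- The height configuration with height `s` at the root whose increment along an edge `(x, y)` is
`U (y, i)`, where `i` is the height at `x`. -/
def chainHeights (hG : G.IsTree) (ρ : V) (s : ℤ) (U : V × ℤ → ℤ) (y : V) : ℤ :=
  (hG.existsUnique_path ρ y).choose.support.tail.foldl (fun i x => i + U (x, i)) s

theorem chainHeights_eq_foldl (hG : G.IsTree) (s : ℤ) (U : V × ℤ → ℤ) {y : V} {p : G.Walk ρ y}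
    (hp : p.IsPath) :
    chainHeights hG ρ s U y = p.support.tail.foldl (fun i x => i + U (x, i)) s := by
  rw [chainHeights, isPath_unique hG (hG.existsUnique_path ρ y).choose_spec.1 hp]

theorem chainHeights_root (hG : G.IsTree) (s : ℤ) (U : V × ℤ → ℤ) :
    chainHeights hG ρ s U ρ = s := by
  simp [chainHeights_eq_foldl hG s U SimpleGraph.Walk.IsPath.nil]

theorem chainHeights_snd (hG : G.IsTree) (s : ℤ) (U : V × ℤ → ℤ) (b : OEdge G ρ) :
    chainHeights hG ρ s U b.1.2 =
      chainHeights hG ρ s U b.1.1 + U (b.1.2, chainHeights hG ρ s U b.1.1) := by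
  obtain ⟨⟨x, y⟩, h⟩ := b
  obtain ⟨p, hp, -⟩ := hG.existsUnique_path ρ x
  rw [chainHeights_eq_foldl hG s U hp, chainHeights_eq_foldl hG s U (h.isPath_concat hG hp),
    SimpleGraph.Walk.support_concat, List.tail_append_of_ne_nil p.support_ne_nil,
    List.foldl_append]
  rfl

theorem measurable_foldl_increment (L : List V) {f : (V × ℤ → ℤ) → ℤ} (hf : Measurable f) :
    Measurable fun U => L.foldl (fun i x => i + U (x, i)) (f U) := by
  induction L generalizing f with
  | nil => exact hf
  | cons x _ ih =>
    have heval : Measurable fun p : (V × ℤ → ℤ) × ℤ => p.1 (x, p.2) :=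
      measurable_from_prod_countable_left fun i => measurable_pi_apply (x, i)
    exact ih (hf.add (heval.comp (measurable_id.prodMk hf)))

theorem measurable_grad : Measurable (grad G ρ) :=
  measurable_pi_lambda _ fun b => (measurable_pi_apply b.1.2).sub (measurable_pi_apply b.1.1)

theorem measurable_grad_chainHeights (hG : G.IsTree) (s : ℤ) :
    Measurable fun U => grad G ρ (chainHeights hG ρ s U) :=
  measurable_grad.comp (measurable_pi_lambda _ fun _ => measurable_foldl_increment _
    measurable_const)

/-- The law of the gradient field of the Markov chain with boundary law `l` that has height `s` at
the root. -/
def chainLaw (hG : G.IsTree) (ρ : V) (hl : IsBoundaryLaw β k l) (s : ℤ) :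
    Measure (GradConf G ρ) :=
  (incrementLaw V hl).map fun U => grad G ρ (chainHeights hG ρ s U)

instance (hG : G.IsTree) (hl : IsBoundaryLaw β k l) (s : ℤ) :
    IsProbabilityMeasure (chainLaw hG ρ hl s) :=
  Measure.isProbabilityMeasure_map (measurable_grad_chainHeights hG s).aemeasurable

/-- The measure assigned to the `q`-periodic boundary law `l`: the Markov chain whose height at the
root is random modulo `q`. -/
def boundaryLawMeasure (hG : G.IsTree) (ρ : V) (q : ℕ) (hl : IsBoundaryLaw β k l) :
    Measure (GradConf G ρ) :=
  ∑ s ∈ Finset.range q, ENNReal.ofReal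
    (conv β l s ^ (k + 1) / ∑ t ∈ Finset.range q, conv β l t ^ (k + 1)) • chainLaw hG ρ hl s

theorem sum_conv_pow_pos (hq : q ≠ 0) (hl : IsBoundaryLaw β k l) :
    0 < ∑ t ∈ Finset.range q, conv β l t ^ (k + 1) :=
  Finset.sum_pos (fun _ _ => pow_pos (hl.conv_pos _) _) (Finset.nonempty_range_iff.2 hq)

theorem isProbabilityMeasure_boundaryLawMeasure (hG : G.IsTree) (hq : q ≠ 0)
    (hl : IsBoundaryLaw β k l) : IsProbabilityMeasure (boundaryLawMeasure hG ρ q hl) := by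
  have hN := sum_conv_pow_pos hq hl
  constructor
  simp only [boundaryLawMeasure, Measure.coe_finsetSum, Finset.sum_apply, Measure.smul_apply,
    measure_univ, smul_eq_mul, mul_one]
  rw [← ENNReal.ofReal_sum_of_nonneg fun s _ => div_nonneg (pow_pos (hl.conv_pos _) _).le hN.le,
    ← Finset.sum_div, div_self hN.ne', ENNReal.ofReal_one]

variable [G.LocallyFinite]

theorem preimage_cyl_chainHeights (hG : G.IsTree) (hΛ : ConnectedOn G Λ) (hρ : ρ ∈ Λ)
    (ω : V → ℤ) :
    (fun U => grad G ρ (chainHeights hG ρ (ω ρ) U)) ⁻¹' cyl Λ (grad G ρ ω) =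
      {U | ∀ b ∈ edgesMeeting G ρ Λ, U (b.1.2, ω b.1.1) = grad G ρ ω b} := by
  ext U
  have hclosure := connectedOn_closureOf hΛ
  have hρ' := subset_closureOf (G := G) Λ hρ
  have hcyl : grad G ρ (chainHeights hG ρ (ω ρ) U) ∈ cyl Λ (grad G ρ ω) ↔
      ∀ x ∈ closureOf G Λ, chainHeights hG ρ (ω ρ) U x = ω x := by
    simp only [cyl, Set.mem_ofPred_eq, hΛ.mem_edgesMeeting_iff hG, and_imp]
    rw [grad_eq_grad_iff hG hclosure]
    refine ⟨fun ⟨c, hc⟩ x hx => ?_, fun h => ⟨0, by simpa using h⟩⟩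
    have := hc ρ hρ'
    rw [chainHeights_root] at this
    rw [hc x hx]
    lia
  rw [Set.mem_preimage, hcyl, Set.mem_ofPred_eq]
  constructor
  · intro h b hb
    obtain ⟨h₁, h₂⟩ := (hΛ.mem_edgesMeeting_iff hG b).1 hb
    rw [grad, ← h _ h₂, chainHeights_snd, h _ h₁, add_sub_cancel_left]
  · intro h
    refine hclosure.induction_oriented hG hρ' (chainHeights_root ..) fun u hu v hv huv ihu => ?_
    have hstep := chainHeights_snd hG (ω ρ) U ⟨(u, v), huv⟩
    rw [ihu, h ⟨(u, v), huv⟩ ((hΛ.mem_edgesMeeting_iff hG _).2 ⟨hu, hv⟩)] at hstep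
    rw [hstep, grad, add_sub_cancel]

theorem chainLaw_cyl (hG : G.IsTree) (hΛ : ConnectedOn G Λ) (hρ : ρ ∈ Λ)
    (hl : IsBoundaryLaw β k l) (ω : V → ℤ) :
    chainLaw hG ρ hl (ω ρ) (cyl Λ (grad G ρ ω)) = ENNReal.ofReal
      (∏ b ∈ edgesMeeting G ρ Λ, Q β (grad G ρ ω b) * (l (ω b.1.2) / conv β l (ω b.1.1))) := by
  classical
  let source : OEdge G ρ → V × ℤ := fun b => (b.1.2, ω b.1.1)
  have hsource : Function.Injective source := fun b b' h => by
    have hsnd : b.1.2 = b'.1.2 := congrArg Prod.fst h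
    exact Subtype.ext (Prod.ext (b.2.eq_of_snd_eq hG (hsnd ▸ b'.2)) hsnd)
  have hpi : {U : V × ℤ → ℤ | ∀ b ∈ edgesMeeting G ρ Λ, U (b.1.2, ω b.1.1) = grad G ρ ω b} =
      Set.pi ((edgesMeeting G ρ Λ).image source) fun i => {ω i.1 - i.2} := by
    ext U
    simp only [Set.mem_ofPred_eq, Set.mem_pi, Finset.mem_coe, Finset.forall_mem_image]
    rfl
  rw [chainLaw, Measure.map_apply (measurable_grad_chainHeights hG _) (measurableSet_cyl _ _),
    preimage_cyl_chainHeights hG hΛ hρ, hpi, incrementLaw,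
    Measure.infinitePi_pi _ fun _ _ => measurableSet_singleton _,
    Finset.prod_image hsource.injOn, ENNReal.ofReal_prod_of_nonneg fun b _ =>
      mul_nonneg (Q_pos _ _).le (div_nonneg (hl.1 _).le (hl.conv_pos _).le)]
  refine Finset.prod_congr rfl fun b _ => ?_
  rw [PMF.toMeasure_apply_singleton _ _ (measurableSet_singleton _), ← mul_div_assoc]
  change ENNReal.ofReal (Q β (ω b.1.2 - ω b.1.1) * l (ω b.1.1 + (ω b.1.2 - ω b.1.1)) /
    conv β l (ω b.1.1)) = _
  rw [add_sub_cancel, grad]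

theorem prod_edgesMeeting_insert_of_connectedOn [DecidableEq V] (hG : G.IsTree) {v : V}
    (hΛ : ConnectedOn G (insert v Λ)) (hρ : ρ ∈ insert v Λ) (hv : v ∉ Λ) (f : V → V → ℝ) :
    ∏ b ∈ edgesMeeting G ρ (insert v Λ), f b.1.1 b.1.2 =
      (∏ b ∈ edgesMeeting G ρ Λ, f b.1.1 b.1.2) * ∏ y ∈ G.neighborFinset v \ Λ, f v y := by
  refine prod_edgesMeeting_insert hG hv _ _ fun e y hy he => ?_
  have hvy : G.Adj v y := by
    rcases he with he | he
    · simpa [he] using e.2.1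
    · simpa [he] using e.2.1.symm
  have horiented : Oriented G ρ (v, y) := hΛ.oriented hG hρ (Finset.mem_insert_self _ _)
    (by simp [hvy.ne', hy]) hvy
  rw [he.resolve_right fun h => horiented.not_symm (h ▸ e.2)]

theorem prod_transition_singleton (hG : G.IsTree) (hdeg : G.degree ρ = k + 1)
    (hl : IsBoundaryLaw β k l) (ω : V → ℤ) :
    conv β l (ω ρ) ^ (k + 1) *
        ∏ b ∈ edgesMeeting G ρ {ρ}, (l (ω b.1.2) / conv β l (ω b.1.1)) =
      ∏ y ∈ outerBoundary G {ρ}, l (ω y) := by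
  classical
  have hempty : edgesMeeting G ρ ∅ = ∅ := Finset.eq_empty_of_forall_notMem fun b => by
    simp [mem_edgesMeeting]
  have hprod := prod_edgesMeeting_insert_of_connectedOn (ρ := ρ) (Λ := ∅) hG
    (connectedOn_singleton ρ) (Finset.mem_insert_self _ _) (Finset.notMem_empty ρ)
    fun x y => l (ω y) / conv β l (ω x)
  rw [insert_empty_eq] at hprod
  rw [hprod, hempty, Finset.prod_empty, one_mul, Finset.sdiff_empty, outerBoundary_singleton,
    Finset.prod_div_distrib, Finset.prod_const, G.card_neighborFinset_eq_degree, hdeg,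
    mul_div_cancel₀ _ (pow_pos (hl.conv_pos _) _).ne']

/-- The transition densities telescope, since `conv β l ^ k` is proportional to `l`. -/
theorem prod_transition (hG : G.IsTree) (hdeg : G.IsRegularOfDegree (k + 1))
    (hΛ : ConnectedOn G Λ) (hρ : ρ ∈ Λ) (hl : IsBoundaryLaw β k l) {c : ℝ}
    (hlc : ∀ i, l i = c * conv β l i ^ k) (ω : V → ℤ) :
    c * conv β l (ω ρ) ^ (k + 1) *
        ∏ b ∈ edgesMeeting G ρ Λ, (l (ω b.1.2) / conv β l (ω b.1.1)) =
      c ^ Λ.card * ∏ y ∈ outerBoundary G Λ, l (ω y) := by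
  classical
  refine (connectedOn_singleton ρ).growth hΛ (Finset.singleton_subset_iff.2 hρ)
    (P := fun Λ => c * conv β l (ω ρ) ^ (k + 1) *
        ∏ b ∈ edgesMeeting G ρ Λ, (l (ω b.1.2) / conv β l (ω b.1.1)) =
      c ^ Λ.card * ∏ y ∈ outerBoundary G Λ, l (ω y)) ?_ fun Λ hρΛ hΛ v hv ih => ?_
  · rw [mul_assoc, prod_transition_singleton hG (hdeg ρ) hl, Finset.card_singleton, pow_one]
  · obtain ⟨⟨u, hu, huv⟩, hvΛ⟩ := mem_outerBoundary.1 hv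
    have hcard : (G.neighborFinset v \ Λ).card = k := by
      have := hΛ.card_neighborFinset_sdiff hG hv
      have := hdeg v
      lia
    have hdisj : Disjoint ((outerBoundary G Λ).erase v) (G.neighborFinset v \ Λ) :=
      (hΛ.disjoint_closureOf hG hv).mono_left
        ((Finset.erase_subset _ _).trans (outerBoundary_subset_closureOf Λ))
    rw [prod_edgesMeeting_insert_of_connectedOn hG (hΛ.insert_adj hu huv)
      (Finset.mem_insert_of_mem (Finset.singleton_subset_iff.1 hρΛ)) hvΛ
      fun x y => l (ω y) / conv β l (ω x), ← mul_assoc, ih, Finset.card_insert_of_notMem hvΛ,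
      outerBoundary_insert, Finset.prod_union hdisj, ← Finset.prod_erase_mul _ _ hv,
      Finset.prod_div_distrib, Finset.prod_const, hcard, hlc (ω v)]
    have := (hl.conv_pos (ω v)).ne'
    field_simp
    ring

theorem hasMarginalOn_boundaryLawMeasure_of_root_mem (hG : G.IsTree)
    (hdeg : G.IsRegularOfDegree (k + 1)) (hΛ : ConnectedOn G Λ) (hρ : ρ ∈ Λ) (hq : q ≠ 0)
    (hper : Function.Periodic l q) (hl : IsBoundaryLaw β k l) :
    HasMarginalOn β q l (boundaryLawMeasure hG ρ q hl) Λ := by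
  obtain ⟨c, hc, hlc⟩ := hl.2.2
  have hN := sum_conv_pow_pos hq hl
  set N := ∑ t ∈ Finset.range q, conv β l t ^ (k + 1)
  refine ⟨c ^ Λ.card / (c * N), by positivity, fun ω => ?_⟩
  set P := ∏ b ∈ edgesMeeting G ρ Λ, Q β (grad G ρ ω b) with hP
  have hP_pos : 0 < P := Finset.prod_pos fun _ _ => Q_pos _ _
  have hterm : ∀ s : ℕ, ENNReal.ofReal (conv β l s ^ (k + 1) / N) *
      chainLaw hG ρ hl s (cyl Λ (grad G ρ ω)) = ENNReal.ofReal
        (c ^ Λ.card / (c * N) * P * ∏ y ∈ outerBoundary G Λ, l (s + (ω y + -ω ρ))) := by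
    intro s
    have hgrad : grad G ρ (fun x => s + (ω x + -ω ρ)) = grad G ρ ω := by
      funext b
      simp [grad]
    have hchain := chainLaw_cyl hG hΛ hρ hl fun x => s + (ω x + -ω ρ)
    have htrans := prod_transition hG hdeg hΛ hρ hl hlc fun x => s + (ω x + -ω ρ)
    have hconv := hl.conv_pos s
    simp only [hgrad, add_neg_cancel, add_zero, Finset.prod_mul_distrib, ← hP] at hchain htrans
    rw [hchain, ← ENNReal.ofReal_mul (by positivity), mul_right_comm, div_mul_eq_mul_div _ (c * N),
      ← htrans]
    congr 1
    field_simp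
  have hterm_nonneg : ∀ s : ℕ,
      0 ≤ c ^ Λ.card / (c * N) * P * ∏ y ∈ outerBoundary G Λ, l (s + (ω y + -ω ρ)) := fun s =>
    mul_nonneg (by positivity) (Finset.prod_nonneg fun _ _ => (hl.1 _).le)
  simp only [boundaryLawMeasure, Measure.coe_finsetSum, Finset.sum_apply, Measure.smul_apply,
    smul_eq_mul]
  rw [Finset.sum_congr rfl fun s _ => hterm s,
    ← ENNReal.ofReal_sum_of_nonneg fun s _ => hterm_nonneg s, ← Finset.mul_sum, mul_right_comm,
    mul_assoc, weight, ← boundarySum_add_const hper _ ω (-ω ρ), boundarySum]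

theorem hasMarginals_boundaryLawMeasure (hG : G.IsTree) (hdeg : G.IsRegularOfDegree (k + 1))
    (hq : q ≠ 0) (hper : Function.Periodic l q) (hl : IsBoundaryLaw β k l) :
    HasMarginals hG ρ β q l (boundaryLawMeasure hG ρ q hl) := by
  classical
  refine (hasMarginals_iff hG hper _).2 fun Λ hΛ => ?_
  obtain ⟨Λ', hsub, hΛ'⟩ := exists_connectedOn_superset hG.1 (insert ρ Λ)
  rw [Finset.insert_subset_iff] at hsub
  exact .of_subset hG hdeg hΛ hΛ' hsub.2 hl
    (hasMarginalOn_boundaryLawMeasure_of_root_mem hG hdeg hΛ' hsub.1 hq hper hl)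

end Construction

section Specification

variable {V : Type*} {G : SimpleGraph V} {ρ : V} {β : ℝ}

theorem measurable_stepGrad (x y : V) : Measurable fun ζ : GradConf G ρ => stepGrad ζ x y := by
  unfold stepGrad
  split_ifs
  · exact measurable_pi_apply _
  · exact (measurable_pi_apply _).neg
  · exact measurable_const

theorem measurable_heights (hG : G.IsTree) : Measurable fun ζ : GradConf G ρ => heights hG ζ := by
  refine measurable_pi_lambda _ fun y => ?_
  simp only [heights, pathSum]
  induction (hG.existsUnique_path ρ y).choose.darts with
  | nil => simp
  | cons d _ ih =>
    simp only [List.map_cons, List.sum_cons]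
    exact (measurable_stepGrad d.fst d.snd).add ih

theorem measurable_glue (Λ : Finset V) (σ : Λ → ℤ) : Measurable (glue Λ σ) := by
  refine measurable_pi_lambda _ fun x => ?_
  unfold glue
  split_ifs
  · exact measurable_const
  · exact measurable_pi_apply x

theorem glue_restrict (Λ : Finset V) (ω : V → ℤ) : glue Λ (fun x => ω x) ω = ω := by
  ext x
  by_cases hx : x ∈ Λ
  · rw [glue_of_mem _ _ hx]
  · rw [glue_of_notMem _ _ hx]

variable [G.LocallyFinite] {Λ Λ' : Finset V}

theorem measurable_boltzmann : Measurable (boltzmann G ρ β Λ) :=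
  ENNReal.measurable_ofReal.comp (Finset.measurable_prod _ fun b _ =>
    (Measurable.of_discrete (f := Q β)).comp ((measurable_pi_apply b).comp measurable_grad))

theorem boltzmann_ne_zero (ω : V → ℤ) : boltzmann G ρ β Λ ω ≠ 0 := by
  rw [boltzmann, ne_eq, ENNReal.ofReal_eq_zero, not_le]
  exact Finset.prod_pos fun _ _ => Q_pos _ _

theorem partitionFn_ne_zero (ω : V → ℤ) : partitionFn G ρ β Λ ω ≠ 0 := fun h =>
  boltzmann_ne_zero _ (ENNReal.tsum_eq_zero.1 h 0)

theorem map_grad_gibbsSpec_apply (ω : V → ℤ) {A : Set (GradConf G ρ)} (hA : MeasurableSet A) :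
    (gibbsSpec G ρ β Λ ω).map (grad G ρ) A = (partitionFn G ρ β Λ ω)⁻¹ *
      ∑' σ : Λ → ℤ, boltzmann G ρ β Λ (glue Λ σ ω) * A.indicator 1 (grad G ρ (glue Λ σ ω)) := by
  have hA' := measurable_grad hA
  rw [Measure.map_apply measurable_grad hA, gibbsSpec, Measure.smul_apply,
    Measure.sum_apply _ hA', smul_eq_mul]
  congr 1
  refine tsum_congr fun σ => ?_
  rw [Measure.smul_apply, Measure.dirac_apply' _ hA', smul_eq_mul]
  rfl

theorem measurable_gradSpec (hG : G.IsTree) : Measurable (gradSpec hG ρ β Λ) := by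
  refine Measure.measurable_of_measurable_coe _ fun A hA => ?_
  simp only [gradSpec, map_grad_gibbsSpec_apply _ hA]
  have hglue : ∀ σ, Measurable fun ζ : GradConf G ρ => glue Λ σ (heights hG ζ) := fun σ =>
    (measurable_glue Λ σ).comp (measurable_heights hG)
  have hboltzmann := fun σ =>
    (measurable_boltzmann (G := G) (ρ := ρ) (β := β) (Λ := Λ)).comp (hglue σ)
  exact (Measurable.tsum hboltzmann).inv.mul (Measurable.tsum fun σ => (hboltzmann σ).mul
    ((measurable_one.indicator hA).comp (measurable_grad.comp (hglue σ))))

theorem tsum_glue_congr [DecidableEq V] (hG : G.IsTree) (hΛ' : ConnectedOn G Λ')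
    {ω ω' : V → ℤ} {c : ℤ} (hc : ∀ x ∈ closureOf G Λ' \ Λ, ω' x = ω x + c)
    {F : GradConf G ρ → ℝ≥0∞} (hF : ∀ η, ∀ η' ∈ cyl Λ' η, F η' = F η) :
    ∑' σ, F (grad G ρ (glue Λ σ ω')) = ∑' σ, F (grad G ρ (glue Λ σ ω)) := by
  rw [← (Equiv.addRight fun _ : Λ => c).tsum_eq]
  refine tsum_congr fun σ => hF _ _ fun b hb => ?_
  obtain ⟨h₁, h₂⟩ := (hΛ'.mem_edgesMeeting_iff hG b).1 hb
  refine (grad_eq_grad_iff hG (connectedOn_closureOf hΛ')).2 ⟨c, fun x hx => ?_⟩ b h₁ h₂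
  by_cases hxΛ : x ∈ Λ
  · simp [glue_of_mem _ _ hxΛ]
  · rw [glue_of_notMem _ _ hxΛ, glue_of_notMem _ _ hxΛ, hc x (Finset.mem_sdiff.2 ⟨hx, hxΛ⟩)]

theorem map_grad_gibbsSpec_cyl_congr [DecidableEq V] (hG : G.IsTree) (hΛ' : ConnectedOn G Λ')
    (hΛ : Λ ⊆ Λ') {ω ω' : V → ℤ} {c : ℤ} (hc : ∀ x ∈ closureOf G Λ' \ Λ, ω' x = ω x + c)
    (ζ : GradConf G ρ) :
    (gibbsSpec G ρ β Λ ω').map (grad G ρ) (cyl Λ' ζ) =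
      (gibbsSpec G ρ β Λ ω).map (grad G ρ) (cyl Λ' ζ) := by
  classical
  let F : GradConf G ρ → ℝ≥0∞ := fun η => ENNReal.ofReal (∏ b ∈ edgesMeeting G ρ Λ, Q β (η b))
  have hF : ∀ η, ∀ η' ∈ cyl Λ' η, F η' = F η := fun η η' h => by
    simp only [F]
    rw [Finset.prod_congr rfl fun b hb => by rw [h b (edgesMeeting_mono hΛ hb)]]
  have hind : ∀ η, ∀ η' ∈ cyl Λ' η,
      F η' * (cyl Λ' ζ).indicator 1 η' = F η * (cyl Λ' ζ).indicator 1 η := fun η η' h => by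
    have hmem : η' ∈ cyl Λ' ζ ↔ η ∈ cyl Λ' ζ := forall₂_congr fun b hb => by rw [h b hb]
    rw [hF η η' h, Set.indicator_apply, Set.indicator_apply, if_congr hmem rfl rfl]
    rfl
  rw [map_grad_gibbsSpec_apply _ (measurableSet_cyl _ _),
    map_grad_gibbsSpec_apply _ (measurableSet_cyl _ _)]
  exact congrArg₂ _ (congrArg _ (tsum_glue_congr hG hΛ' hc hF)) (tsum_glue_congr hG hΛ' hc hind)

theorem map_grad_gibbsSpec_cyl_self (hG : G.IsTree) (hΛ' : ConnectedOn G Λ')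
    (hΛ : Λ ⊂ closureOf G Λ') (ω : V → ℤ) :
    (gibbsSpec G ρ β Λ ω).map (grad G ρ) (cyl Λ' (grad G ρ ω)) =
      (partitionFn G ρ β Λ ω)⁻¹ * boltzmann G ρ β Λ ω := by
  have hself : ∀ ζ : GradConf G ρ, ζ ∈ cyl Λ' ζ := fun _ _ _ => rfl
  rw [map_grad_gibbsSpec_apply _ (measurableSet_cyl _ _), tsum_eq_single (fun x : Λ => ω x),
    glue_restrict, Set.indicator_of_mem (hself _), Pi.one_apply, mul_one]
  intro σ hσ
  rw [Set.indicator_of_notMem, mul_zero]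
  have hdisj := pairwise_disjoint_cyl_glue (ρ := ρ) hG hΛ' hΛ ω hσ
  rw [Function.onFun, glue_restrict] at hdisj
  exact Set.disjoint_left.1 hdisj (hself _)

theorem gradSpec_cyl (hG : G.IsTree) (hΛ' : ConnectedOn G Λ') (hsub : Λ ⊆ Λ')
    (hΛ : Λ ⊂ closureOf G Λ') (ω : V → ℤ) (ζ : GradConf G ρ) :
    gradSpec hG ρ β Λ ζ (cyl Λ' (grad G ρ ω)) =
      (⋃ σ, cyl Λ' (grad G ρ (glue Λ σ ω))).indicator
        (fun _ => (partitionFn G ρ β Λ ω)⁻¹ * boltzmann G ρ β Λ ω) ζ := by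
  classical
  by_cases hζ : ζ ∈ ⋃ σ, cyl Λ' (grad G ρ (glue Λ σ ω))
  · obtain ⟨c, hc⟩ := (mem_iUnion_cyl_glue_iff hG hΛ' Λ).1 hζ
    rw [Set.indicator_of_mem hζ, gradSpec, map_grad_gibbsSpec_cyl_congr hG hΛ' hsub hc,
      map_grad_gibbsSpec_cyl_self hG hΛ' hΛ]
  · rw [Set.indicator_of_notMem hζ, gradSpec,
      map_grad_gibbsSpec_apply _ (measurableSet_cyl _ _), ENNReal.tsum_eq_zero.2, mul_zero]
    intro σ
    rw [Set.indicator_of_notMem, mul_zero]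
    intro hσ
    have hclosure := connectedOn_closureOf hΛ'
    simp only [cyl, Set.mem_ofPred_eq, hΛ'.mem_edgesMeeting_iff hG, and_imp,
      grad_eq_grad_iff hG hclosure] at hσ
    obtain ⟨c, hc⟩ := hσ
    refine hζ ((mem_iUnion_cyl_glue_iff hG hΛ' Λ).2 ⟨c, fun x hx => ?_⟩)
    rw [Finset.mem_sdiff] at hx
    rw [← hc x hx.1, glue_of_notMem _ _ hx.2]

variable {q : ℕ} {l : ℤ → ℝ} {ν : Measure (GradConf G ρ)}

theorem HasMarginalOn.exists_eq_mul_boltzmann (hq : q ≠ 0) (hl : ∀ i, 0 < l i) (hΛ : Λ ⊆ Λ')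
    (h : HasMarginalOn β q l ν Λ') (ω : V → ℤ) :
    ∃ κ ≠ 0, ∀ σ, ν (cyl Λ' (grad G ρ (glue Λ σ ω))) = κ * boltzmann G ρ β Λ (glue Λ σ ω) := by
  classical
  obtain ⟨Z, hZ, H⟩ := h
  let E := edgesMeeting G ρ Λ' \ edgesMeeting G ρ Λ
  have hκ : 0 < Z * boundarySum q l (outerBoundary G Λ') ω * ∏ b ∈ E, Q β (grad G ρ ω b) :=
    mul_pos (mul_pos hZ (boundarySum_pos hq hl _ _)) (Finset.prod_pos fun _ _ => Q_pos _ _)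
  refine ⟨_, (ENNReal.ofReal_pos.2 hκ).ne', fun σ => ?_⟩
  have hboundary : ∀ y ∈ outerBoundary G Λ', glue Λ σ ω y = ω y := fun y hy =>
    glue_of_notMem _ _ fun hyΛ => (mem_outerBoundary.1 hy).2 (hΛ hyΛ)
  have hexterior : ∀ b ∈ E, grad G ρ (glue Λ σ ω) b = grad G ρ ω b := fun b hb => by
    have hbΛ := (Finset.mem_sdiff.1 hb).2
    rw [mem_edgesMeeting, not_or] at hbΛ
    rw [grad, grad, glue_of_notMem _ _ hbΛ.1, glue_of_notMem _ _ hbΛ.2]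
  rw [H, weight, boltzmann, ← ENNReal.ofReal_mul hκ.le, boundarySum_congr hboundary,
    ← Finset.prod_sdiff (edgesMeeting_mono hΛ),
    Finset.prod_congr rfl fun b hb => by rw [hexterior b hb], mul_assoc, mul_assoc]

theorem HasMarginalOn.lintegral_gradSpec_cyl [IsFiniteMeasure ν] (hG : G.IsTree)
    (hΛ' : ConnectedOn G Λ') (hsub : Λ ⊆ Λ') (hΛ : Λ ⊂ closureOf G Λ') (hq : q ≠ 0)
    (hl : ∀ i, 0 < l i) (h : HasMarginalOn β q l ν Λ') (ω : V → ℤ) :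
    ∫⁻ ζ, gradSpec hG ρ β Λ ζ (cyl Λ' (grad G ρ ω)) ∂ν = ν (cyl Λ' (grad G ρ ω)) := by
  obtain ⟨κ, hκ, hν⟩ := h.exists_eq_mul_boltzmann hq hl hsub ω
  have hunion : ν (⋃ σ, cyl Λ' (grad G ρ (glue Λ σ ω))) = κ * partitionFn G ρ β Λ ω := by
    rw [measure_iUnion (pairwise_disjoint_cyl_glue hG hΛ' hΛ ω) fun _ => measurableSet_cyl _ _,
      partitionFn, ← ENNReal.tsum_mul_left]
    exact tsum_congr hν
  have hfinite : partitionFn G ρ β Λ ω ≠ ∞ := fun htop => by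
    rw [htop, ENNReal.mul_top hκ] at hunion
    exact measure_ne_top ν _ hunion
  have hself := hν fun x => ω x
  rw [glue_restrict] at hself
  simp only [gradSpec_cyl hG hΛ' hsub hΛ]
  rw [lintegral_indicator_const (MeasurableSet.iUnion fun _ => measurableSet_cyl _ _), hunion,
    hself, mul_right_comm, mul_left_comm,
    ENNReal.inv_mul_cancel (partitionFn_ne_zero ω) hfinite, mul_one]

theorem isGGM_of_hasMarginals [Infinite V] [IsProbabilityMeasure ν] (hG : G.IsTree) (hq : q ≠ 0)
    (hl : ∀ i, 0 < l i) (hper : Function.Periodic l q) (h : HasMarginals hG ρ β q l ν) :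
    IsGGM hG ρ β ν := by
  refine ⟨inferInstance, fun Λ A hA => ?_⟩
  have hbind : ∀ A, MeasurableSet A →
      ν.bind (gradSpec hG ρ β Λ) A = ∫⁻ ζ, gradSpec hG ρ β Λ ζ A ∂ν := fun A hA =>
    Measure.bind_apply hA (measurable_gradSpec hG).aemeasurable
  have hinvariant : ν.bind (gradSpec hG ρ β Λ) = ν :=
    measure_ext_of_cyl hG (Λ₀ := Λ) fun Λ' hsub hΛ' ω => by
      obtain ⟨v, hv⟩ := outerBoundary_nonempty hG.1 (Finset.nonempty_coe_sort.1 hΛ'.nonempty)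
      have hΛ : Λ ⊂ closureOf G Λ' := (Finset.ssubset_iff_of_subset
        (hsub.trans (subset_closureOf Λ'))).2 ⟨v, outerBoundary_subset_closureOf Λ' hv,
          fun hvΛ => (mem_outerBoundary.1 hv).2 (hsub hvΛ)⟩
      rw [hbind _ (measurableSet_cyl _ _)]
      exact ((hasMarginals_iff hG hper ν).1 h Λ' hΛ').lintegral_gradSpec_cyl hG hΛ' hsub hΛ hq hl ω
  rw [← hbind A hA, hinvariant]

theorem HasMarginals.unique {μ : Measure (GradConf G ρ)} [IsProbabilityMeasure μ]
    [IsProbabilityMeasure ν] (hG : G.IsTree) (hper : Function.Periodic l q)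
    (hμ : HasMarginals hG ρ β q l μ) (hν : HasMarginals hG ρ β q l ν) : μ = ν := by
  rw [hasMarginals_iff hG hper] at hμ hν
  refine measure_ext_of_cyl hG (Λ₀ := ∅) fun Λ _ hΛ ω => ?_
  obtain ⟨Y, hY, hμΛ⟩ := hμ Λ hΛ
  obtain ⟨Z, hZ, hνΛ⟩ := hν Λ hΛ
  have hprop : ∀ ω, μ (cyl Λ (grad G ρ ω)) = (ENNReal.ofReal (Y / Z) • ν) (cyl Λ (grad G ρ ω)) :=
    fun ω => by
      rw [Measure.smul_apply, smul_eq_mul, hμΛ, hνΛ, ← ENNReal.ofReal_mul (by positivity),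
        ← mul_assoc, div_mul_cancel₀ _ hZ.ne']
  have hone := congrArg (· Set.univ) (map_restrict_eq_of_cyl hG hprop)
  simp only [Measure.map_apply (Finset.measurable_restrict _) MeasurableSet.univ,
    Set.preimage_univ, Measure.smul_apply, measure_univ, smul_eq_mul, mul_one] at hone
  rw [hprop, ← hone, one_smul]

theorem IsBoundaryLaw.existsUnique_isGGM {k : ℕ} (hG : G.IsTree)
    (hdeg : G.IsRegularOfDegree (k + 1)) (hk : k ≠ 0) (hq : q ≠ 0) (hper : Function.Periodic l q)
    (hl : IsBoundaryLaw β k l) : ∃! ν, IsGGM hG ρ β ν ∧ HasMarginals hG ρ β q l ν := by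
  have : Infinite V := infinite_of_two_le_degree hG fun v => by
    have := hdeg v
    lia
  have := isProbabilityMeasure_boundaryLawMeasure (ρ := ρ) hG hq hl
  have hmarginals := hasMarginals_boundaryLawMeasure (ρ := ρ) hG hdeg hq hper hl
  refine ⟨_, ⟨isGGM_of_hasMarginals hG hq hl.1 hper hmarginals, hmarginals⟩, fun μ hμ => ?_⟩
  have := hμ.1.1
  exact hμ.2.unique hG hper hmarginals

end Specification

section FourPeriodic

variable {β : ℝ} {l : ℤ → ℝ}

theorem Q_eq_pow_natAbs (β : ℝ) (m : ℤ) : Q β m = Real.exp (-β) ^ m.natAbs := by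
  rw [Q, ← Real.exp_nat_mul, Nat.cast_natAbs, Int.cast_abs, mul_comm]

theorem summable_Q (hβ : 0 < β) : Summable (Q β) := by
  have h : Summable fun n : ℕ => Q β n := by
    simp only [Q_eq_pow_natAbs, Int.natAbs_natCast]
    exact summable_geometric_of_lt_one (Real.exp_pos _).le (by simpa using hβ)
  exact Summable.of_nat_of_neg h (by simpa only [Q_neg] using h)

theorem summable_Q_mul (hβ : 0 < β) {C : ℝ} (hl : ∀ i, |l i| ≤ C) (i : ℤ) :
    Summable fun j => Q β (i - j) * l j := by
  refine (((Equiv.subLeft i).summable_iff.2 (summable_Q hβ)).mul_right C).of_norm_bounded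
    fun j => ?_
  rw [Real.norm_eq_abs, abs_mul, abs_of_pos (Q_pos _ _)]
  exact mul_le_mul_of_nonneg_left (hl j) (Q_pos _ _).le

theorem Q_add_one_add_Q_sub_one (β : ℝ) (m : ℤ) :
    Q β (m + 1) + Q β (m - 1) =
      2 * Real.cosh β * Q β m - if m = 0 then 2 * Real.sinh β else 0 := by
  wlog hm : 0 ≤ m generalizing m
  · have h := this (-m) (by lia)
    rw [Q_neg, ← Q_neg β (-m + 1), ← Q_neg β (-m - 1)] at h
    simpa only [neg_add, neg_sub, neg_neg, sub_neg_eq_add, neg_eq_zero, add_comm,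
      ← sub_eq_add_neg] using h
  have hexp : Real.exp (-β) * Real.exp β = 1 := by
    rw [← Real.exp_add, neg_add_cancel, Real.exp_zero]
  obtain rfl | hpos := hm.eq_or_lt
  · norm_num [Q_eq_pow_natAbs, Real.cosh_eq, Real.sinh_eq]
    ring
  · obtain ⟨n, rfl⟩ : ∃ n : ℕ, m = n + 1 := ⟨m.toNat - 1, by lia⟩
    rw [if_neg hpos.ne', Q_eq_pow_natAbs, Q_eq_pow_natAbs, Q_eq_pow_natAbs,
      show (n + 1 + 1 : ℤ).natAbs = n + 2 by lia, show (n + 1 - 1 : ℤ).natAbs = n by lia,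
      show (n + 1 : ℤ).natAbs = n + 1 by lia, Real.cosh_eq]
    linear_combination -Real.exp (-β) ^ n * hexp

theorem conv_add_one_add_conv_sub_one (hs : ∀ i, Summable fun j => Q β (i - j) * l j) (i : ℤ) :
    conv β l (i + 1) + conv β l (i - 1) =
      2 * Real.cosh β * conv β l i - 2 * Real.sinh β * l i := by
  refine ((hs (i + 1)).hasSum.add (hs (i - 1)).hasSum).unique
    ((((hs i).hasSum.mul_left (2 * Real.cosh β)).sub
      (hasSum_ite_eq i (2 * Real.sinh β * l i))).congr_fun fun j => ?_)
  rw [add_sub_right_comm, sub_right_comm, ← add_mul, Q_add_one_add_Q_sub_one, sub_mul, mul_assoc,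
    ite_mul, zero_mul]
  by_cases h : j = i
  · simp [h]
  · rw [if_neg h, if_neg (by lia)]

theorem conv_add (l : ℤ → ℝ) (i t : ℤ) : conv β l (i + t) = conv β (fun j => l (j + t)) i := by
  rw [conv, conv, ← (Equiv.addRight t).tsum_eq]
  exact tsum_congr fun j => by simp

theorem conv_neg (l : ℤ → ℝ) (i : ℤ) : conv β l (-i) = conv β (fun j => l (-j)) i := by
  rw [conv, conv, ← (Equiv.neg ℤ).tsum_eq]
  exact tsum_congr fun j => by rw [Equiv.neg_apply, ← Q_neg, neg_sub_neg, neg_sub]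

theorem isBoundaryLaw_iff_of_apply_zero {k : ℕ} (h0 : l 0 = 1) :
    IsBoundaryLaw β k l ↔ (∀ i, 0 < l i) ∧ (∀ i, Summable fun j => Q β (i - j) * l j) ∧
      ∀ i, l i = (conv β l i / conv β l 0) ^ k := by
  constructor
  · rintro ⟨hl, hs, c, -, hfix⟩
    change ∀ i, l i = c * conv β l i ^ k at hfix
    refine ⟨hl, hs, fun i => ?_⟩
    rw [div_pow, eq_div_iff (pow_pos (conv_pos hl hs 0) k).ne', hfix i]
    linear_combination (conv β l i) ^ k * (hfix 0).symm.trans h0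
  · rintro ⟨hl, hs, hfix⟩
    have hconv := conv_pos hl hs 0
    refine ⟨hl, hs, (conv β l 0 ^ k)⁻¹, by positivity, fun i => ?_⟩
    rw [hfix i, div_pow, div_eq_inv_mul]
    rfl

variable {a b : ℝ}

theorem fourPeriodic_zero (a b : ℝ) : fourPeriodic a b 0 = 1 := by simp [fourPeriodic]

theorem fourPeriodic_one (a b : ℝ) : fourPeriodic a b 1 = a ^ 2 := by simp [fourPeriodic]

theorem fourPeriodic_add_two (a b : ℝ) (n : ℤ) : fourPeriodic a b (n + 2) = fourPeriodic b a n := by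
  unfold fourPeriodic
  split_ifs <;> first | rfl | lia

theorem fourPeriodic_neg (a b : ℝ) (n : ℤ) : fourPeriodic a b (-n) = fourPeriodic b a n := by
  unfold fourPeriodic
  split_ifs <;> first | rfl | lia

theorem periodic_fourPeriodic (a b : ℝ) : Function.Periodic (fourPeriodic a b) (4 : ℕ) :=
  fun n => by
    rw [show n + ((4 : ℕ) : ℤ) = n + 2 + 2 by lia, fourPeriodic_add_two, fourPeriodic_add_two]

theorem fourPeriodic_pos (ha : 0 < a) (hb : 0 < b) (n : ℤ) : 0 < fourPeriodic a b n := by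
  unfold fourPeriodic
  split_ifs <;> positivity

theorem summable_Q_mul_fourPeriodic (hβ : 0 < β) (a b : ℝ) (i : ℤ) :
    Summable fun j => Q β (i - j) * fourPeriodic a b j :=
  summable_Q_mul hβ (C := 1 + a ^ 2 + b ^ 2) (fun j => by
    unfold fourPeriodic
    split_ifs <;> rw [abs_of_nonneg (by positivity)] <;> linarith [sq_nonneg a, sq_nonneg b]) i

theorem conv_fourPeriodic_add_two (a b : ℝ) (i : ℤ) :
    conv β (fourPeriodic a b) (i + 2) = conv β (fourPeriodic b a) i := by
  rw [conv_add, funext (fourPeriodic_add_two a b)]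

theorem conv_fourPeriodic_neg (a b : ℝ) (i : ℤ) :
    conv β (fourPeriodic a b) (-i) = conv β (fourPeriodic b a) i := by
  rw [conv_neg, funext (fourPeriodic_neg a b)]

theorem two_lt_two_mul_cosh (hβ : 0 < β) : 2 < 2 * Real.cosh β := by
  linarith [Real.one_lt_cosh.2 hβ.ne']

/-- The equation at odd heights for `fourPeriodic a b` to be a boundary law of the binary tree,
cleared of denominators and square roots; the parameter `τ` stands for `2 * cosh β`. -/
def LawEq (τ a b : ℝ) : Prop :=
  a * (τ * (τ + a ^ 2 + b ^ 2)) = 2 * τ + (τ ^ 2 - 2) * a ^ 2 + 2 * b ^ 2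

theorem conv_fourPeriodic_one_div_zero (hβ : 0 < β) (a b : ℝ) {τ : ℝ} (hτ : τ = 2 * Real.cosh β) :
    conv β (fourPeriodic a b) 1 / conv β (fourPeriodic a b) 0 =
      (2 * τ + (τ ^ 2 - 2) * a ^ 2 + 2 * b ^ 2) / (τ * (τ + a ^ 2 + b ^ 2)) := by
  have hτ2 : 2 < τ := hτ ▸ two_lt_two_mul_cosh hβ
  have hsinh : 0 < 2 * Real.sinh β := mul_pos two_pos (Real.sinh_pos_iff.2 hβ)
  have hrec := conv_add_one_add_conv_sub_one (summable_Q_mul_fourPeriodic hβ a b)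
  have hzero := hrec 0
  have hone := hrec 1
  have hneg_one := hrec (-1)
  have hnegTwo : conv β (fourPeriodic a b) (-2) = conv β (fourPeriodic a b) 0 := by
    rw [conv_fourPeriodic_neg, ← zero_add 2, conv_fourPeriodic_add_two]
  have htwo : conv β (fourPeriodic a b) 2 = conv β (fourPeriodic a b) 0 := by
    rw [← zero_add 2, conv_fourPeriodic_add_two, ← conv_fourPeriodic_neg, neg_zero]
  norm_num [hnegTwo, htwo, fourPeriodic_zero, fourPeriodic_one, fourPeriodic_neg, ← hτ]
    at hzero hone hneg_one
  have hsolved : (τ ^ 2 - 4) * conv β (fourPeriodic a b) 0 =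
      2 * Real.sinh β * (τ + a ^ 2 + b ^ 2) := by
    linear_combination -τ * hzero - hone - hneg_one
  have hτ4 : 0 < τ ^ 2 - 4 := by nlinarith
  have hconv : conv β (fourPeriodic a b) 0 ≠ 0 := fun h => by
    rw [h, mul_zero] at hsolved
    exact hsolved.not_lt (mul_pos hsinh (by positivity))
  rw [div_eq_div_iff hconv (by positivity)]
  linear_combination -(τ + a ^ 2 + b ^ 2) * hone - a ^ 2 * hsolved

theorem isBoundaryLaw_fourPeriodic_iff (hβ : 0 < β) (ha : 0 < a) (hb : 0 < b) {τ : ℝ}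
    (hτ : τ = 2 * Real.cosh β) :
    IsBoundaryLaw β 2 (fourPeriodic a b) ↔ LawEq τ a b ∧ LawEq τ b a := by
  have hτ2 : 2 < τ := hτ ▸ two_lt_two_mul_cosh hβ
  have hτ4 : 0 < τ ^ 2 - 2 := by nlinarith
  let IsFixed (a b : ℝ) (i : ℤ) : Prop :=
    fourPeriodic a b i = (conv β (fourPeriodic a b) i / conv β (fourPeriodic a b) 0) ^ 2
  have hshift : ∀ a b i, IsFixed a b (i + 2) = IsFixed b a i := fun a b i => by
    have hconv : conv β (fourPeriodic b a) 0 = conv β (fourPeriodic a b) 0 := by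
      rw [← conv_fourPeriodic_neg, neg_zero]
    simp only [IsFixed]
    rw [fourPeriodic_add_two, conv_fourPeriodic_add_two, hconv]
  have hperiodic : Function.Periodic (IsFixed a b) 4 := fun i => by
    rw [show i + 4 = i + 2 + 2 by lia, hshift, hshift]
  have heven : ∀ {a b}, 0 < a → 0 < b → IsFixed a b 0 := fun ha hb => by
    have hpos := conv_pos (fourPeriodic_pos ha hb) (summable_Q_mul_fourPeriodic hβ _ _) 0
    simp only [IsFixed]
    rw [fourPeriodic_zero, div_self hpos.ne', one_pow]
  have hodd : ∀ {a b}, 0 < a → 0 < b → (IsFixed a b 1 ↔ LawEq τ a b) := fun ha hb => by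
    simp only [IsFixed]
    rw [fourPeriodic_one, conv_fourPeriodic_one_div_zero hβ _ _ hτ,
      pow_left_inj₀ ha.le (by positivity) two_ne_zero, eq_div_iff (by positivity), LawEq]
  rw [isBoundaryLaw_iff_of_apply_zero (fourPeriodic_zero a b), ← hodd ha hb, ← hodd hb ha]
  refine ⟨fun h => ⟨h.2.2 1, (hshift a b 1) ▸ h.2.2 3⟩, fun h => ⟨fourPeriodic_pos ha hb,
    summable_Q_mul_fourPeriodic hβ a b, fun i => ?_⟩⟩
  obtain ⟨j, ⟨hj0, hj4⟩, hij⟩ := hperiodic.exists_mem_Ico₀ four_pos i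
  change IsFixed a b i
  rw [hij]
  interval_cases j
  · exact heven ha hb
  · exact h.1
  · exact (hshift a b 0).symm ▸ heven hb ha
  · exact (hshift a b 1).symm ▸ h.2

end FourPeriodic

section Solutions

variable {τ a b : ℝ}

/-- The solutions of the boundary-law equations with `a = b`, up to `(a, a) ↦ (a⁻¹, a⁻¹)`: this
symmetry preserves the assigned measure. -/
def diagonalSolutions (τ : ℝ) : Set ℝ := {a | 1 ≤ a ∧ LawEq τ a a}

/-- The solutions of the boundary-law equations with `a ≠ b`, up to `(a, b) ↦ (b, a)`: this
symmetry preserves the assigned measure. -/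
def offDiagonalSolutions (τ : ℝ) : Set (ℝ × ℝ) :=
  {p | 0 < p.2 ∧ p.2 < p.1 ∧ LawEq τ p.1 p.2 ∧ LawEq τ p.2 p.1}

/-- The values of `a + b` on the solutions of the boundary-law equations with `a ≠ b`. The second
condition is the positivity of the discriminant of the polynomial with roots `a` and `b`. -/
def offDiagonalSums (τ : ℝ) : Set ℝ := {s | s ^ 2 - τ * s + τ = 0 ∧ 8 < τ * s}

theorem lawEq_self_iff (hτ : τ ≠ 0) :
    LawEq τ a a ↔ a = 1 ∨ 2 * a ^ 2 - (τ - 2) * a + 2 = 0 := by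
  have hfactor : a * (τ * (τ + a ^ 2 + a ^ 2)) - (2 * τ + (τ ^ 2 - 2) * a ^ 2 + 2 * a ^ 2) =
      τ * ((a - 1) * (2 * a ^ 2 - (τ - 2) * a + 2)) := by ring
  rw [LawEq, ← sub_eq_zero, hfactor, mul_eq_zero_iff_left hτ, mul_eq_zero, sub_eq_zero]

theorem encard_diagonalSolutions_of_le (hτ : τ ≠ 0) (hτ6 : τ ≤ 6) :
    (diagonalSolutions τ).encard = 1 := by
  refine Set.encard_eq_one.2 ⟨1, Set.eq_singleton_iff_unique_mem.2
    ⟨⟨le_rfl, (lawEq_self_iff hτ).2 (Or.inl rfl)⟩, fun a ⟨ha, h⟩ => ?_⟩⟩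
  refine ((lawEq_self_iff hτ).1 h).elim id fun hquadratic => ?_
  have hsq : (a - 1) ^ 2 ≤ 0 := by nlinarith
  exact sub_eq_zero.1 (pow_eq_zero_iff two_ne_zero |>.1 (hsq.antisymm (sq_nonneg _)))

theorem encard_diagonalSolutions_of_lt (hτ : 6 < τ) : (diagonalSolutions τ).encard = 2 := by
  have hτ0 : τ ≠ 0 := by positivity
  have hdiscrim : 0 ≤ (τ - 2) ^ 2 - 16 := by nlinarith
  set r := √((τ - 2) ^ 2 - 16)
  have hr : r ^ 2 = (τ - 2) ^ 2 - 16 := Real.sq_sqrt hdiscrim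
  have hr0 : 0 ≤ r := Real.sqrt_nonneg _
  have hroot : 1 < (τ - 2 + r) / 4 := by linarith
  have hset : diagonalSolutions τ = {1, (τ - 2 + r) / 4} := by
    ext a
    simp only [diagonalSolutions, lawEq_self_iff hτ0, Set.mem_ofPred_eq, Set.mem_insert_iff,
      Set.mem_singleton_iff]
    constructor
    · rintro ⟨ha, rfl | h⟩
      · exact Or.inl rfl
      · have hfactor : (a - (τ - 2 + r) / 4) * (a - (τ - 2 - r) / 4) = 0 := by
          linear_combination h / 2 - hr / 16
        refine Or.inr ((mul_eq_zero.1 hfactor).elim sub_eq_zero.1 fun hother => ?_)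
        nlinarith
    · rintro (rfl | rfl)
      · exact ⟨le_rfl, Or.inl rfl⟩
      · exact ⟨hroot.le, Or.inr (by linear_combination hr / 8)⟩
  rw [hset, Set.encard_pair hroot.ne]

theorem lawEq_and_lawEq_swap_iff (hτ : τ ^ 2 ≠ 4) (hab : a ≠ b) :
    LawEq τ a b ∧ LawEq τ b a ↔
      (a + b) ^ 2 - τ * (a + b) + τ = 0 ∧ τ * (a * b) = 2 * (a + b) := by
  unfold LawEq
  constructor
  · rintro ⟨h₁, h₂⟩
    have hdiff : τ * (τ + a ^ 2 + b ^ 2) = (τ ^ 2 - 4) * (a + b) :=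
      mul_left_cancel₀ (sub_ne_zero.2 hab) (by linear_combination h₁ - h₂)
    have hsum : (a + b) ^ 2 - τ * (a + b) + τ = 0 :=
      mul_left_cancel₀ (sub_ne_zero.2 hτ) (by linear_combination h₁ + h₂ - (a + b - τ) * hdiff)
    exact ⟨hsum, by linear_combination (τ * hsum - hdiff) / 2⟩
  · rintro ⟨hsum, hprod⟩
    have hdiff : τ * (τ + a ^ 2 + b ^ 2) = (τ ^ 2 - 4) * (a + b) := by
      linear_combination τ * hsum - 2 * hprod
    exact ⟨by linear_combination a * hdiff - 2 * hsum + τ * hprod,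
      by linear_combination b * hdiff - 2 * hsum + τ * hprod⟩

theorem eq_and_eq_or_swap_of_add_eq_of_mul_eq {a' b' : ℝ} (hadd : a + b = a' + b')
    (hmul : a * b = a' * b') : (a = a' ∧ b = b') ∨ (a = b' ∧ b = a') := by
  have h : (a - a') * (a - b') = 0 := by linear_combination a * hadd - hmul
  rcases mul_eq_zero.1 h with h | h
  · exact Or.inl ⟨by linarith, by linarith⟩
  · exact Or.inr ⟨by linarith, by linarith⟩

theorem exists_add_eq_and_mul_eq {s p : ℝ} (hs : 0 < s) (hp : 0 < p) (hsp : 4 * p < s ^ 2) :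
    ∃ a b : ℝ, 0 < b ∧ b < a ∧ a + b = s ∧ a * b = p := by
  have hdiscrim : 0 < s ^ 2 - 4 * p := sub_pos.2 hsp
  set r := √(s ^ 2 - 4 * p)
  have hr : r ^ 2 = s ^ 2 - 4 * p := Real.sq_sqrt hdiscrim.le
  have hr0 : 0 < r := Real.sqrt_pos.2 hdiscrim
  have hrs : r < s := lt_of_pow_lt_pow_left₀ 2 hs.le (by linarith)
  exact ⟨(s + r) / 2, (s - r) / 2, by linarith, by linarith, by ring, by linear_combination -hr / 4⟩

theorem bijOn_add_offDiagonalSolutions (hτ : 2 < τ) :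
    Set.BijOn (fun p : ℝ × ℝ => p.1 + p.2) (offDiagonalSolutions τ) (offDiagonalSums τ) := by
  have hτ4 : τ ^ 2 ≠ 4 := by nlinarith
  refine ⟨fun ⟨a, b⟩ ⟨hb, hba, h⟩ => ?_, fun ⟨a, b⟩ ⟨_, hba, h⟩ ⟨a', b'⟩ ⟨_, hba', h'⟩ hadd => ?_,
    fun s ⟨hs, hs8⟩ => ?_⟩
  · obtain ⟨hsum, hprod⟩ := (lawEq_and_lawEq_swap_iff hτ4 hba.ne').1 h
    dsimp only at *
    refine ⟨hsum, sub_pos.1 (pos_of_mul_pos_right ?_ (by linarith : 0 ≤ a + b))⟩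
    have hdiscrim : (a + b) * (τ * (a + b) - 8) = τ * (a - b) ^ 2 := by linear_combination 4 * hprod
    have := sub_pos.2 hba
    rw [hdiscrim]
    positivity
  · have hprod := ((lawEq_and_lawEq_swap_iff hτ4 hba.ne').1 h).2
    have hprod' := ((lawEq_and_lawEq_swap_iff hτ4 hba'.ne').1 h').2
    dsimp only at *
    have hmul : a * b = a' * b' :=
      mul_left_cancel₀ (by linarith : τ ≠ 0) (by rw [hprod, hprod', hadd])
    rcases eq_and_eq_or_swap_of_add_eq_of_mul_eq hadd hmul with ⟨rfl, rfl⟩ | ⟨rfl, rfl⟩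
    · rfl
    · exact absurd hba hba'.not_gt
  · have hτ0 : 0 < τ := two_pos.trans hτ
    have hs0 : 0 < s := pos_of_mul_pos_right (by linarith : 0 < τ * s) hτ0.le
    have hdiscrim : 4 * (2 * s / τ) < s ^ 2 := by
      rw [← mul_div_assoc, div_lt_iff₀ hτ0]
      nlinarith
    obtain ⟨a, b, hb, hba, rfl, hprod⟩ := exists_add_eq_and_mul_eq hs0 (by positivity) hdiscrim
    refine ⟨(a, b), ⟨hb, hba, (lawEq_and_lawEq_swap_iff hτ4 hba.ne').2 ⟨hs, ?_⟩⟩, rfl⟩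
    rw [hprod, mul_div_cancel₀ _ hτ0.ne']

theorem encard_offDiagonalSolutions (hτ : 2 < τ) :
    (offDiagonalSolutions τ).encard = (offDiagonalSums τ).encard := by
  have h := bijOn_add_offDiagonalSolutions hτ
  rw [← h.image_eq, h.injOn.encard_image]

theorem offDiagonalSums_eq_empty (hτ : 0 < τ) (hτ4 : τ ≤ 4) : offDiagonalSums τ = ∅ := by
  refine Set.eq_empty_of_forall_notMem fun s ⟨hs, hs8⟩ => ?_
  have hs2 : 2 < s := by nlinarith
  nlinarith [sq_pos_of_pos (sub_pos.2 hs2)]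

theorem exists_roots_of_four_lt (hτ : 4 < τ) : ∃ u v : ℝ, v < u ∧ 8 < τ * u ∧
    (∀ s, s ^ 2 - τ * s + τ = 0 ↔ s = u ∨ s = v) ∧ (8 < τ * v ↔ 2 + 2 * √5 < τ) := by
  have hdiscrim : 0 < τ ^ 2 - 4 * τ := by nlinarith
  set r := √(τ ^ 2 - 4 * τ)
  have hr : r ^ 2 = τ ^ 2 - 4 * τ := Real.sq_sqrt hdiscrim.le
  have hr0 : 0 < r := Real.sqrt_pos.2 hdiscrim
  have hu : 8 < τ * ((τ + r) / 2) := by nlinarith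
  refine ⟨(τ + r) / 2, (τ - r) / 2, by linarith, hu, fun s => ?_, ?_⟩
  · have hfactor : s ^ 2 - τ * s + τ = (s - (τ + r) / 2) * (s - (τ - r) / 2) := by
      linear_combination hr / 4
    rw [hfactor, mul_eq_zero, sub_eq_zero, sub_eq_zero]
  · have hproduct : (τ * ((τ - r) / 2) - 8) * (τ * ((τ + r) / 2) - 8) =
        (τ - 4) * ((τ - 2) ^ 2 - (2 * √5) ^ 2) := by
      rw [mul_pow, Real.sq_sqrt (by norm_num)]
      linear_combination -τ ^ 2 / 4 * hr
    rw [← sub_pos, ← mul_pos_iff_of_pos_right (sub_pos.2 hu), hproduct,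
      mul_pos_iff_of_pos_left (sub_pos.2 hτ), sub_pos,
      pow_lt_pow_iff_left₀ (by positivity) (by linarith) two_ne_zero, lt_sub_iff_add_lt']

theorem encard_offDiagonalSums_of_le (hτ : 4 < τ) (hτ5 : τ ≤ 2 + 2 * √5) :
    (offDiagonalSums τ).encard = 1 := by
  obtain ⟨u, v, -, hu, hroots, hv⟩ := exists_roots_of_four_lt hτ
  refine Set.encard_eq_one.2 ⟨u, Set.eq_singleton_iff_unique_mem.2
    ⟨⟨(hroots u).2 (Or.inl rfl), hu⟩, fun s ⟨hs, hs8⟩ => ((hroots s).1 hs).resolve_right ?_⟩⟩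
  rintro rfl
  exact hτ5.not_gt (hv.1 hs8)

theorem encard_offDiagonalSums_of_lt (hτ : 4 < τ) (hτ5 : 2 + 2 * √5 < τ) :
    (offDiagonalSums τ).encard = 2 := by
  obtain ⟨u, v, hvu, hu, hroots, hv⟩ := exists_roots_of_four_lt hτ
  refine Set.encard_eq_two.2 ⟨u, v, hvu.ne', Set.ext fun s => ⟨fun hs => (hroots s).1 hs.1, ?_⟩⟩
  rintro (rfl | rfl)
  · exact ⟨(hroots _).2 (Or.inl rfl), hu⟩
  · exact ⟨(hroots _).2 (Or.inr rfl), hv.2 hτ5⟩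

end Solutions

section Symmetries

variable {V : Type*} {G : SimpleGraph V} [G.LocallyFinite] {hG : G.IsTree} {ρ : V} {β : ℝ}
  {q : ℕ} {l l' : ℤ → ℝ} {ν : Measure (GradConf G ρ)} {a b κ τ : ℝ} {t : ℤ}

theorem boundarySum_of_shift (hper : Function.Periodic l q) (hl' : ∀ n, l' n = κ * l (n + t))
    (S : Finset V) (ω : V → ℤ) :
    boundarySum q l' S ω = κ ^ S.card * boundarySum q l S ω := by
  rw [← boundarySum_add_const hper S ω t, boundarySum, boundarySum, Finset.mul_sum]
  simp only [hl', Finset.prod_mul_distrib, Finset.prod_const, add_assoc]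

theorem HasMarginals.of_shift (hper : Function.Periodic l q) (hκ : 0 < κ)
    (hl' : ∀ n, l' n = κ * l (n + t)) (h : HasMarginals hG ρ β q l ν) :
    HasMarginals hG ρ β q l' ν := by
  have hper' : Function.Periodic l' q := fun n => by rw [hl', hl', add_right_comm, hper]
  rw [hasMarginals_iff hG hper] at h
  refine (hasMarginals_iff hG hper' ν).2 fun Λ hΛ => ?_
  obtain ⟨Z, hZ, hν⟩ := h Λ hΛ
  refine ⟨Z / κ ^ (outerBoundary G Λ).card, by positivity, fun ω => ?_⟩
  rw [hν, weight, weight, boundarySum_of_shift hper hl', mul_assoc, ← mul_assoc (_ / _),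
    div_mul_cancel₀ _ (by positivity)]

theorem HasMarginals.fourPeriodic_swap (h : HasMarginals hG ρ β 4 (fourPeriodic a b) ν) :
    HasMarginals hG ρ β 4 (fourPeriodic b a) ν :=
  h.of_shift (periodic_fourPeriodic a b) one_pos fun n => by
    rw [one_mul, fourPeriodic_add_two]

theorem HasMarginals.fourPeriodic_inv (ha : 0 < a)
    (h : HasMarginals hG ρ β 4 (fourPeriodic a a) ν) :
    HasMarginals hG ρ β 4 (fourPeriodic a⁻¹ a⁻¹) ν := by
  refine h.of_shift (periodic_fourPeriodic a a) (κ := (a ^ 2)⁻¹) (t := 1) (by positivity)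
    fun n => ?_
  unfold fourPeriodic
  split_ifs <;> first | lia | field_simp

theorem LawEq.inv (ha : a ≠ 0) (h : LawEq τ a a) : LawEq τ a⁻¹ a⁻¹ := by
  unfold LawEq at h ⊢
  field_simp
  linear_combination -h

/-- Representatives, under the symmetries `(a, b) ↦ (b, a)` and `(a, a) ↦ (a⁻¹, a⁻¹)`, of the
pairs `(a, b)` for which `fourPeriodic a b` is a boundary law. -/
def lawRepresentatives (τ : ℝ) : Set (ℝ × ℝ) :=
  (fun a => (a, a)) '' diagonalSolutions τ ∪ offDiagonalSolutions τ

theorem lawRepresentatives_spec {p : ℝ × ℝ} (hp : p ∈ lawRepresentatives τ) :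
    0 < p.1 ∧ 0 < p.2 ∧ p.2 ≤ p.1 ∧ LawEq τ p.1 p.2 ∧ LawEq τ p.2 p.1 := by
  rcases hp with ⟨a, ⟨ha, h⟩, rfl⟩ | ⟨hb, hba, h⟩
  · exact ⟨by positivity, by positivity, le_rfl, h, h⟩
  · exact ⟨hb.trans hba, hb, hba.le, h⟩

theorem one_le_of_mem_lawRepresentatives (h : (a, a) ∈ lawRepresentatives τ) : 1 ≤ a := by
  rcases h with ⟨_, ⟨ha, -⟩, heq⟩ | ⟨-, hlt, -⟩
  · exact (Prod.mk.inj heq).1 ▸ ha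
  · exact absurd hlt (lt_irrefl a)

theorem encard_lawRepresentatives (τ : ℝ) : (lawRepresentatives τ).encard =
    (diagonalSolutions τ).encard + (offDiagonalSolutions τ).encard := by
  have hinj : Function.Injective fun a : ℝ => (a, a) := fun _ _ h => (Prod.mk.inj h).1
  have hdisjoint : Disjoint ((fun a : ℝ => (a, a)) '' diagonalSolutions τ)
      (offDiagonalSolutions τ) := by
    refine Set.disjoint_left.2 ?_
    rintro _ ⟨a, -, rfl⟩ ⟨-, hlt, -⟩
    exact lt_irrefl a hlt
  rw [lawRepresentatives, Set.encard_union_eq hdisjoint, hinj.encard_image]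

theorem HasMarginals.exists_lawRepresentative (ha : 0 < a) (hb : 0 < b)
    (hlaw : LawEq τ a b ∧ LawEq τ b a) (h : HasMarginals hG ρ β 4 (fourPeriodic a b) ν) :
    ∃ p ∈ lawRepresentatives τ, HasMarginals hG ρ β 4 (fourPeriodic p.1 p.2) ν := by
  rcases lt_trichotomy b a with hba | rfl | hab
  · exact ⟨(a, b), Or.inr ⟨hb, hba, hlaw⟩, h⟩
  · rcases le_total 1 b with hone | hone
    · exact ⟨(b, b), Or.inl ⟨b, ⟨hone, hlaw.1⟩, rfl⟩, h⟩
    · exact ⟨(b⁻¹, b⁻¹), Or.inl ⟨b⁻¹, ⟨(one_le_inv₀ hb).2 hone, hlaw.1.inv hb.ne'⟩, rfl⟩,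
        h.fourPeriodic_inv hb⟩
  · exact ⟨(b, a), Or.inr ⟨ha, hab, hlaw.symm⟩, h.fourPeriodic_swap⟩

end Symmetries

section Rigidity

variable {V : Type*} {G : SimpleGraph V} [G.LocallyFinite] {hG : G.IsTree} {ρ v : V} {β : ℝ}
  {q : ℕ} {l l' : ℤ → ℝ} {ν : Measure (GradConf G ρ)} {Λ : Finset V} {a b a' b' τ : ℝ}

theorem HasMarginalOn.exists_boundarySum_eq_mul (hl : ∀ i, 0 < l i) (hl' : ∀ i, 0 < l' i)
    (h : HasMarginalOn β q l ν Λ) (h' : HasMarginalOn β q l' ν Λ) :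
    ∃ c : ℝ, 0 < c ∧ ∀ ω, boundarySum q l (outerBoundary G Λ) ω =
      c * boundarySum q l' (outerBoundary G Λ) ω := by
  obtain ⟨Z, hZ, hν⟩ := h
  obtain ⟨Z', hZ', hν'⟩ := h'
  refine ⟨Z' / Z, by positivity, fun ω => ?_⟩
  have heq := (hν ω).symm.trans (hν' ω)
  rw [ENNReal.ofReal_eq_ofReal_iff (mul_nonneg hZ.le (weight_nonneg hl Λ ω))
    (mul_nonneg hZ'.le (weight_nonneg hl' Λ ω)), weight, weight, ← mul_assoc, ← mul_assoc] at heq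
  rw [div_mul_eq_mul_div, eq_div_iff hZ.ne', mul_comm]
  exact mul_right_cancel₀ (Finset.prod_pos fun b _ => Q_pos β (grad G ρ ω b)).ne' heq

theorem exists_boundarySum_outerBoundary_singleton (v : V) (h : Fin (G.degree v) → ℤ) :
    ∃ ω : V → ℤ, ∀ q l, boundarySum q l (outerBoundary G {v}) ω =
      ∑ s ∈ Finset.range q, ∏ i, l (s + h i) := by
  let e : ↥(outerBoundary G {v}) ≃ Fin (G.degree v) :=
    Finset.equivFinOfCardEq (by rw [outerBoundary_singleton, G.card_neighborFinset_eq_degree])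
  refine ⟨glue _ (h ∘ e) 0, fun q l => Finset.sum_congr rfl fun s _ => ?_⟩
  rw [← Finset.prod_coe_sort, ← e.prod_comp]
  exact Finset.prod_congr rfl fun y _ => by rw [glue_of_mem _ _ y.2]; rfl

theorem HasMarginalOn.exists_sum_prod_eq_mul (hl : ∀ i, 0 < l i) (hl' : ∀ i, 0 < l' i)
    (h : HasMarginalOn β q l ν {v}) (h' : HasMarginalOn β q l' ν {v}) :
    ∃ c : ℝ, 0 < c ∧ ∀ n : Fin (G.degree v) → ℤ, ∑ s ∈ Finset.range q, ∏ i, l (s + n i) =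
      c * ∑ s ∈ Finset.range q, ∏ i, l' (s + n i) := by
  obtain ⟨c, hc, hsum⟩ := h.exists_boundarySum_eq_mul hl hl' h'
  refine ⟨c, hc, fun n => ?_⟩
  obtain ⟨ω, hω⟩ := exists_boundarySum_outerBoundary_singleton v n
  rw [← hω, ← hω, hsum]

/-- The sums over a period of products of three values of `fourPeriodic a b`, for `A = a ^ 2` and
`B = b ^ 2`, are `c` times those for `A'` and `B'`. The three arguments are a common height plus the
relative heights `(0, 0, 0)`, `(0, 0, 1)`, `(0, 0, 2)` or `(0, 1, 2)`, which suffice to recover the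
two values up to the symmetries. -/
structure ProportionalStarSums (A B A' B' c : ℝ) : Prop where
  h000 : 2 + A ^ 3 + B ^ 3 = c * (2 + A' ^ 3 + B' ^ 3)
  h001 : A + A ^ 2 + B + B ^ 2 = c * (A' + A' ^ 2 + B' + B' ^ 2)
  h002 : 2 + A ^ 2 * B + A * B ^ 2 = c * (2 + A' ^ 2 * B' + A' * B' ^ 2)
  h012 : A + B + 2 * (A * B) = c * (A' + B' + 2 * (A' * B'))

variable {A B A' B' c : ℝ}

theorem ProportionalStarSums.sq_sub (h : ProportionalStarSums A B A' B' c) :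
    (A - B) ^ 2 = c * (A' - B') ^ 2 := by
  linear_combination h.h001 - h.h012

theorem ProportionalStarSums.eq_or_mul_eq_one (hA : 0 < A) (hA' : 0 < A')
    (h : ProportionalStarSums A A A' A' c) : A = A' ∨ A * A' = 1 := by
  have hfactor : (1 + A) * (1 + A') * ((A - A') * (A * A' - 1)) = 0 := by
    linear_combination (A' + A' ^ 2) * h.h000 / 2 - (1 + A' ^ 3) * h.h001 / 2
  simpa [sub_eq_zero, (by positivity : (1 + A) * (1 + A') ≠ 0)] using hfactor

theorem ProportionalStarSums.eq_or_swap (hA : 0 < A) (hB : 0 < B) (hAB : A ≠ B)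
    (h : ProportionalStarSums A B A' B' c) : (A = A' ∧ B = B') ∨ (A = B' ∧ B = A') := by
  have hsq : (A - B) ^ 2 ≠ 0 := pow_ne_zero 2 (sub_ne_zero.2 hAB)
  have hadd : A + B = A' + B' := mul_right_cancel₀ hsq (by
    linear_combination h.h000 - h.h002 - (A' + B') * h.sq_sub)
  have hc : c = 1 := by
    have hpos : 0 < 2 * (A + B) + (A + B) ^ 2 := by positivity
    refine mul_right_cancel₀ hpos.ne' ?_
    linear_combination c * (2 + A + B + A' + B') * hadd - h.h001 - h.h012
  have hmul : A * B = A' * B' := by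
    have h012 := h.h012
    rw [hc] at h012
    linear_combination (h012 - hadd) / 2
  exact eq_and_eq_or_swap_of_add_eq_of_mul_eq hadd hmul

theorem ProportionalStarSums.rigidity (hA : 0 < A) (hB : 0 < B) (hA' : 0 < A') (hc : c ≠ 0)
    (h : ProportionalStarSums A B A' B' c) :
    (A = B ∧ A' = B' ∧ (A = A' ∨ A * A' = 1)) ∨ (A = A' ∧ B = B') ∨ (A = B' ∧ B = A') := by
  rcases eq_or_ne A B with rfl | hAB
  · have hsq := h.sq_sub
    obtain rfl : A' = B' := by simpa [hc, sub_eq_zero, eq_comm] using hsq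
    exact Or.inl ⟨rfl, rfl, h.eq_or_mul_eq_one hA hA'⟩
  · exact Or.inr (h.eq_or_swap hA hB hAB)

theorem HasMarginals.exists_proportionalStarSums (hdeg : G.degree ρ = 3) (ha : 0 < a) (hb : 0 < b)
    (ha' : 0 < a') (hb' : 0 < b') (h : HasMarginals hG ρ β 4 (fourPeriodic a b) ν)
    (h' : HasMarginals hG ρ β 4 (fourPeriodic a' b') ν) :
    ∃ c, 0 < c ∧ ProportionalStarSums (a ^ 2) (b ^ 2) (a' ^ 2) (b' ^ 2) c := by
  rw [hasMarginals_iff hG (periodic_fourPeriodic _ _)] at h h'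
  obtain ⟨c, hc, hsum⟩ := (h {ρ} (connectedOn_singleton ρ)).exists_sum_prod_eq_mul
    (fourPeriodic_pos ha hb) (fourPeriodic_pos ha' hb') (h' {ρ} (connectedOn_singleton ρ))
  rw [hdeg] at hsum
  have h000 := hsum ![0, 0, 0]
  have h001 := hsum ![0, 0, 1]
  have h002 := hsum ![0, 0, 2]
  have h012 := hsum ![0, 1, 2]
  simp only [Finset.sum_range_succ, Fin.prod_univ_three, Matrix.cons_val] at h000 h001 h002 h012
  norm_num [fourPeriodic] at h000 h001 h002 h012
  exact ⟨c, hc, by linear_combination h000, by linear_combination h001,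
    by linear_combination h002, by linear_combination h012⟩

theorem HasMarginals.fourPeriodic_rigidity (hdeg : G.degree ρ = 3) (ha : 0 < a) (hb : 0 < b)
    (ha' : 0 < a') (hb' : 0 < b') (h : HasMarginals hG ρ β 4 (fourPeriodic a b) ν)
    (h' : HasMarginals hG ρ β 4 (fourPeriodic a' b') ν) :
    (a = b ∧ a' = b' ∧ (a = a' ∨ a * a' = 1)) ∨ (a = a' ∧ b = b') ∨ (a = b' ∧ b = a') := by
  obtain ⟨c, hc, hsums⟩ := h.exists_proportionalStarSums hdeg ha hb ha' hb' h'
  have hrigid := hsums.rigidity (by positivity) (by positivity) (by positivity) hc.ne'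
  have hone : (a * a') ^ 2 = 1 ↔ a * a' = 1 := pow_eq_one_iff_of_nonneg (by positivity) two_ne_zero
  simpa only [← mul_pow, hone, pow_left_inj₀ ha.le hb.le two_ne_zero,
    pow_left_inj₀ ha'.le hb'.le two_ne_zero, pow_left_inj₀ ha.le ha'.le two_ne_zero,
    pow_left_inj₀ hb.le hb'.le two_ne_zero, pow_left_inj₀ ha.le hb'.le two_ne_zero,
    pow_left_inj₀ hb.le ha'.le two_ne_zero] using hrigid

theorem HasMarginals.eq_of_mem_lawRepresentatives (hdeg : G.degree ρ = 3) {p p' : ℝ × ℝ}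
    (hp : p ∈ lawRepresentatives τ) (hp' : p' ∈ lawRepresentatives τ)
    (h : HasMarginals hG ρ β 4 (fourPeriodic p.1 p.2) ν)
    (h' : HasMarginals hG ρ β 4 (fourPeriodic p'.1 p'.2) ν) : p = p' := by
  obtain ⟨ha, hb, hba, -⟩ := lawRepresentatives_spec hp
  obtain ⟨ha', hb', hba', -⟩ := lawRepresentatives_spec hp'
  obtain ⟨a, b⟩ := p
  obtain ⟨a', b'⟩ := p'
  dsimp only at *
  rcases h.fourPeriodic_rigidity hdeg ha hb ha' hb' h' with
    ⟨rfl, rfl, rfl | hmul⟩ | ⟨rfl, rfl⟩ | ⟨rfl, rfl⟩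
  · rfl
  · have hone := one_le_of_mem_lawRepresentatives hp
    have hone' := one_le_of_mem_lawRepresentatives hp'
    obtain rfl : a = 1 := by nlinarith
    rw [one_mul] at hmul
    rw [hmul]
  · rfl
  · rw [hba.antisymm hba']

end Rigidity

section Counting

variable {V : Type*} {G : SimpleGraph V} [G.LocallyFinite] {β τ : ℝ}

theorem encard_fourPeriodicGGMs (hG : G.IsTree) (hdeg : G.IsRegularOfDegree 3) (ρ : V)
    (hβ : 0 < β) (hτ : τ = 2 * Real.cosh β) :
    (fourPeriodicGGMs hG ρ β).encard =
      (diagonalSolutions τ).encard + (offDiagonalSolutions τ).encard := by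
  have hexists : ∀ p ∈ lawRepresentatives τ, ∃! ν,
      IsGGM hG ρ β ν ∧ HasMarginals hG ρ β 4 (fourPeriodic p.1 p.2) ν := fun p hp => by
    obtain ⟨ha, hb, -, hlaw⟩ := lawRepresentatives_spec hp
    exact ((isBoundaryLaw_fourPeriodic_iff hβ ha hb hτ).2 hlaw).existsUnique_isGGM hG hdeg
      two_ne_zero four_ne_zero (periodic_fourPeriodic _ _)
  choose! ν hν hunique using hexists
  have hinj : Set.InjOn ν (lawRepresentatives τ) := fun p hp p' hp' heq =>
    (hν p hp).2.eq_of_mem_lawRepresentatives (hdeg ρ) hp hp' (heq ▸ (hν p' hp').2)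
  have himage : ν '' lawRepresentatives τ = fourPeriodicGGMs hG ρ β := by
    refine Set.Subset.antisymm (Set.image_subset_iff.2 fun p hp => ?_) ?_
    · obtain ⟨ha, hb, -, hlaw⟩ := lawRepresentatives_spec hp
      exact ⟨(hν p hp).1, p.1, p.2, ha, hb,
        (isBoundaryLaw_fourPeriodic_iff hβ ha hb hτ).2 hlaw, (hν p hp).2⟩
    · rintro μ ⟨hμ, a, b, ha, hb, hl, hmarginals⟩
      obtain ⟨p, hp, hmarginals'⟩ := hmarginals.exists_lawRepresentative ha hb
        ((isBoundaryLaw_fourPeriodic_iff hβ ha hb hτ).1 hl)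
      exact ⟨p, hp, (hunique p hp μ ⟨hμ, hmarginals'⟩).symm⟩
  rw [← himage, hinj.encard_image, encard_lawRepresentatives]

end Counting

end SOS

end

theorem mainTheorem1 {V : Type*} (G : SimpleGraph V) [G.LocallyFinite] (hG : G.IsTree)
    (hdeg : G.IsRegularOfDegree 3) (ρ : V) (β : ℝ) (hβ : 0 < β) (τ : ℝ)
    (hτ : τ = 2 * Real.cosh β) :
    (τ ≤ 4 → (SOS.fourPeriodicGGMs hG ρ β).encard = 1) ∧
    (4 < τ → τ ≤ 6 → (SOS.fourPeriodicGGMs hG ρ β).encard = 2) ∧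
    (6 < τ → τ ≤ 2 + 2 * √5 → (SOS.fourPeriodicGGMs hG ρ β).encard = 3) ∧
    (2 + 2 * √5 < τ → (SOS.fourPeriodicGGMs hG ρ β).encard = 4) := by
  have hτ2 : 2 < τ := hτ ▸ SOS.two_lt_two_mul_cosh hβ
  have hτ0 : τ ≠ 0 := by positivity
  have hsqrt : 2 < √5 := Real.lt_sqrt_of_sq_lt (by norm_num)
  rw [SOS.encard_fourPeriodicGGMs hG hdeg ρ hβ hτ, SOS.encard_offDiagonalSolutions hτ2]
  refine ⟨fun h => ?_, fun h h₆ => ?_, fun h₆ h => ?_, fun h => ?_⟩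
  · rw [SOS.encard_diagonalSolutions_of_le hτ0 (by linarith),
      SOS.offDiagonalSums_eq_empty (by linarith) h, Set.encard_empty, add_zero]
  · rw [SOS.encard_diagonalSolutions_of_le hτ0 h₆,
      SOS.encard_offDiagonalSums_of_le h (by linarith), one_add_one_eq_two]
  · rw [SOS.encard_diagonalSolutions_of_lt h₆,
      SOS.encard_offDiagonalSums_of_le (by linarith) h, two_add_one_eq_three]
  · rw [SOS.encard_diagonalSolutions_of_lt (by linarith),
      SOS.encard_offDiagonalSums_of_lt (by linarith) h, two_add_two_eq_four]
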